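/- **Interval models.** All intervals are closed intervals $[\ell,r]\subset\mathbb R$ with $\ell\le r$. An interval model $\mathcal M$ is a finite multiset of intervals; its intersection graph $\mathbb G(\mathcal M)$ has the members of $\mathcal M$ as vertices, two distinct members being adjacent iff they have a common point. For a finite graph $G$, $\mathrm{mc}(G)$ is the maximum, over all partitions of $V(G)$ into two parts $A,B$, of the number of edges with one end in $A$ and the other in $B$. **Grained gadgets.** An $(x,y)$-grained gadget is an interval model $\mathcal H=\mathcal{LS}\cup\mathcal{LL}\cup\mathcal{RS}\cup\mathcal{RL}$ (four separate parts) with $|\mathcal{LS}|=|\mathcal{RS}|=x$ and $|\mathcal{LL}|=|\mathcal{RL}|=y$, such that any two members of $\mathcal{LL}\cup\mathcal{RL}$ intersect, a member of $\mathcal{LS}$ intersects another member of $\mathcal H$ iff the latter is in $\mathcal{LL}$, and a member of $\mathcal{RS}$ intersects another member of $\mathcal H$ iff the latter is in $\mathcal{RL}$. An interval $I$ outside $\mathcal H$ *covers* $\mathcal H$ if it contains every member of $\mathcal H$; it *weakly intersects $\mathcal H$ to the left* (*right*) if the members of $\mathcal H$ that it intersects are exactly those of $\mathcal{LL}$ (of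 $\mathcal{RL}$); it *strongly intersects $\mathcal H$ to the left* if they are exactly those of $\mathcal{LS}\cup\mathcal{LL}$. **The construction.** Let $G$ be a cubic graph on $n$ vertices with an ordering $v_1,\dots,v_n$ of its vertices and an ordering $e_1,\dots,e_m$ of its $m=3n/2$ edges; write $\mathfrak G$ for $G$ with these orderings. Put $$q=28n^3+1,\quad p=2q+7n,\quad q'=18n^3+1,\quad p'=2q'+5n .$$ Let $\mathcal M(\mathfrak G)$ be any interval model that consists of $(p,q)$-grained gadgets $\mathcal H_i^j$ ($1\le i\le n$, $1\le j\le m+1$), intervals $L_i^1,\dots,L_i^{2m}$ ($1\le i\le n$), $(p',q')$-grained gadgets $\mathcal E_j$ and intervals $C_j^1,\dots,C_j^4$ ($1\le j\le m$) and satisfies the following conditions, in which $\mathcal D$ denotes the submodel formed by all $\mathcal H_i^j$ and all $L_i^h$. 1. Members of two different gadgets $\mathcal H_i^j$, $\mathcal H_{i'}^{j'}$, $(i,j)\ne(i',j')$, never intersect. 2. For all $i$ and all $j\le m$, $L_i^{2j-1}$ and $L_i^{2j}$ are true twins in $\mathbb G(\mathcal D)$ (have the same closed neighbourhood), weakly intersect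 $\mathcal H_i^j$ to the right and weakly intersect $\mathcal H_i^{j+1}$ to the left. 3. For all $2\le i\le n$ and all $j\le m$, $L_{i-1}^{2j-1}$ and $L_{i-1}^{2j}$ cover $\mathcal H_i^j$, and $L_i^{2j-1}$ and $L_i^{2j}$ cover $\mathcal H_{i-1}^{j+1}$. 4. For all $j\le m$, a member $I$ of $\mathcal D$ intersects a given member of $\mathcal E_j$ iff $I$ is one of $L_h^{2j-1},L_h^{2j}$, $1\le h\le n$, and each of these intervals covers $\mathcal E_j$. 5. For each edge $e_j=v_iv_{i'}$ with $i<i'$, $C_j^1$ and $C_j^2$ are true twins in $\mathbb G(\mathcal M(\mathfrak G))$, weakly intersect $\mathcal H_i^j$ to the right and weakly intersect $\mathcal E_j$ to the left; $C_j^3$ and $C_j^4$ are true twins in $\mathbb G(\mathcal M(\mathfrak G))$, weakly intersect $\mathcal H_{i'}^j$ to the right and strongly intersect $\mathcal E_j$ to the left. **Lemma.** For every positive integer $k$, $\mathrm{mc}(G)\ge k$ if and only if $\mathrm{mc}(\mathbb G(\mathcal M(\mathfrak G)))\ge f(G,k)$, where $$\begin{aligned} f(G,k)={}&\left(\tfrac{3n^2}{2}+n\right)(2pq+q^2)+\tfrac{3n}{2}\left(2p'q'+q'^2\right)+6nq(n+1)\\&+(3n^2+3n)(n-1)(p+q)+3n^2(p'+q')+3np'+2kq'+4k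 .\end{aligned}$$ -/

import Mathlib

namespace IntervalMaxCut

/-! ### Cuts -/

/-- The cut-set of `G` associated with the cut `[A, Aᶜ]`. -/
def cutSet {V : Type*} (G : SimpleGraph V) (A : Set V) : Set (Sym2 V) :=
  {e | e ∈ G.edgeSet ∧ ∃ u ∈ A, ∃ v ∈ Aᶜ, e = s(u, v)}

/-- The maximum size of a cut-set of a finite graph. -/
noncomputable def maxCut {V : Type*} [Finite V] (G : SimpleGraph V) : ℕ :=
  ⨆ A : Set V, (cutSet G A).ncard

/-! ### Interval models

An interval model is a finite multiset of closed intervals `[ℓ, r]`, `ℓ ≤ r`, of the real line; it is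
given here as a family of intervals indexed by a finite type. -/

/-- Two closed intervals have a common point. -/
def Meets (I J : NonemptyInterval ℝ) : Prop :=
  ((I : Set ℝ) ∩ (J : Set ℝ)).Nonempty

/-- The intersection graph of an interval model. -/
def intersectionGraph {ι : Type*} (M : ι → NonemptyInterval ℝ) : SimpleGraph ι where
  Adj u v := u ≠ v ∧ Meets (M u) (M v)
  symm := ⟨fun _ _ h => ⟨h.1.symm, by
    have h2 := h.2
    unfold Meets at h2 ⊢
    rwa [Set.inter_comm]⟩⟩
  loopless := ⟨fun _ h => h.1 rfl⟩

/-- `u` and `v` are true twins: they have the same closed neighbourhood. -/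
def TrueTwins {ι : Type*} (G : SimpleGraph ι) (u v : ι) : Prop :=
  insert u (G.neighborSet u) = insert v (G.neighborSet v)

/-! ### Grained gadgets -/

/-- The names of the intervals of an `(x, y)`-grained gadget: `x` left short, `y` left long,
`x` right short and `y` right long intervals. -/
inductive GadgetIdx (x y : ℕ) : Type
  | ls (a : Fin x)
  | ll (a : Fin y)
  | rs (a : Fin x)
  | rl (a : Fin y)
  deriving DecidableEq, Fintype

namespace GadgetIdx

variable {x y : ℕ}

/-- The left short intervals. -/
def LS : Set (GadgetIdx x y) := Set.range ls

/-- The left long intervals. -/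
def LL : Set (GadgetIdx x y) := Set.range ll

/-- The right short intervals. -/
def RS : Set (GadgetIdx x y) := Set.range rs

/-- The right long intervals. -/
def RL : Set (GadgetIdx x y) := Set.range rl

end GadgetIdx

open GadgetIdx

/-- The family `H` is an `(x, y)`-grained gadget. -/
structure IsGrainedGadget {x y : ℕ} (H : GadgetIdx x y → NonemptyInterval ℝ) : Prop where
  long_meets : ∀ a ∈ LL ∪ RL, ∀ b ∈ LL ∪ RL, Meets (H a) (H b)
  left_short : ∀ a ∈ LS, ∀ b, b ≠ a → (Meets (H a) (H b) ↔ b ∈ LL)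
  right_short : ∀ a ∈ RS, ∀ b, b ≠ a → (Meets (H a) (H b) ↔ b ∈ RL)

section

variable {x y : ℕ} (I : NonemptyInterval ℝ) (H : GadgetIdx x y → NonemptyInterval ℝ)

/-- `I` contains every interval of `H`. -/
def Covers : Prop := ∀ a, (H a : Set ℝ) ⊆ (I : Set ℝ)

/-- `I` weakly intersects `H` to the left. -/
def WeaklyLeft : Prop := ∀ a, Meets I (H a) ↔ a ∈ LL

/-- `I` weakly intersects `H` to the right. -/
def WeaklyRight : Prop := ∀ a, Meets I (H a) ↔ a ∈ RL

/-- `I` strongly intersects `H` to the left. -/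
def StronglyLeft : Prop := ∀ a, Meets I (H a) ↔ a ∈ LS ∪ LL

end

/-! ### Escalators -/

/-- The names of the intervals of an `(n, m)`-escalator with `(p, q)`-grained gadgets.
`gadget i j a` ranges over the intervals of the gadget of the vertex number `i` in region `j`, and
`link i j 0`, `link i j 1` are the two link intervals of the vertex number `i` in region `j`
(with indices from 1 they are `L_i^{2j-1}` and `L_i^{2j}`). -/
inductive EscalatorIdx (n m p q : ℕ) : Type
  | gadget (i : Fin n) (j : Fin (m + 1)) (a : GadgetIdx p q)
  | link (i : Fin n) (j : Fin m) (b : Fin 2)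
  deriving DecidableEq, Fintype

/-- The family `D` is an `(n, m)`-escalator with `(p, q)`-grained gadgets. -/
structure IsEscalator {n m p q : ℕ} (D : EscalatorIdx n m p q → NonemptyInterval ℝ) : Prop where
  grained : ∀ i j, IsGrainedGadget fun a => D (.gadget i j a)
  /-- The grained gadgets are mutually disjoint. -/
  disjoint : ∀ i j i' j', (i, j) ≠ (i', j') →
    ∀ a a', ¬ Meets (D (.gadget i j a)) (D (.gadget i' j' a'))
  link_twins : ∀ i j, TrueTwins (intersectionGraph D) (.link i j 0) (.link i j 1)
  link_right : ∀ i j b, WeaklyRight (D (.link i j b)) fun a => D (.gadget i j.castSucc a)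
  link_left : ∀ i j b, WeaklyLeft (D (.link i j b)) fun a => D (.gadget i j.succ a)
  /-- The links of a vertex cover the gadget of the next vertex in the same region. -/
  link_covers_next : ∀ i i' : Fin n, (i' : ℕ) = i + 1 → ∀ j b,
    Covers (D (.link i j b)) fun a => D (.gadget i' j.castSucc a)
  /-- The links of a vertex cover the gadget of the previous vertex in the next region. -/
  link_covers_prev : ∀ i i' : Fin n, (i' : ℕ) = i + 1 → ∀ j b,
    Covers (D (.link i' j b)) fun a => D (.gadget i j.succ a)

/-! ### The reduction model -/

/-- The names of the intervals of the reduction model: those of the escalator, those of the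
`(p', q')`-grained gadgets `E_j`, and `C_j^1, …, C_j^4`, which are `conn j 0, …, conn j 3`. -/
inductive ModelIdx (n m p q p' q' : ℕ) : Type
  | esc (d : EscalatorIdx n m p q)
  | edge (j : Fin m) (a : GadgetIdx p' q')
  | conn (j : Fin m) (c : Fin 4)
  deriving DecidableEq, Fintype

/-- The family `M` is a model constructed from the graph `G`, the ordering `πV` of its vertices and
the ordering `πE` of its edges, with `(p, q)`-grained gadgets for the vertices and `(p', q')`-grained
gadgets for the edges. -/
structure IsReductionModel {V : Type*} (G : SimpleGraph V) {n m : ℕ} (πV : Fin n ≃ V)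
    (πE : Fin m ≃ G.edgeSet) {p q p' q' : ℕ}
    (M : ModelIdx n m p q p' q' → NonemptyInterval ℝ) : Prop where
  escalator : IsEscalator fun d => M (.esc d)
  grained : ∀ j, IsGrainedGadget fun a => M (.edge j a)
  /-- The intervals of the escalator that meet an interval of `E_j` are exactly the links of
  region `j`. -/
  esc_meets_edge : ∀ j d a, Meets (M (.esc d)) (M (.edge j a)) ↔ ∃ i b, d = .link i j b
  link_covers_edge : ∀ i j b, Covers (M (.esc (.link i j b))) fun a => M (.edge j a)
  conn12_twins : ∀ j, TrueTwins (intersectionGraph M) (.conn j 0) (.conn j 1)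
  conn34_twins : ∀ j, TrueTwins (intersectionGraph M) (.conn j 2) (.conn j 3)
  /-- If `e_j = v_i v_i'` with `i < i'`, then `C_j^1` and `C_j^2` weakly intersect the gadget of
  `v_i` in region `j` to the right, and weakly intersect `E_j` to the left. -/
  conn12 : ∀ j i i', i < i' → (πE j : Sym2 V) = s(πV i, πV i') → ∀ c : Fin 4, c = 0 ∨ c = 1 →
    WeaklyRight (M (.conn j c)) (fun a => M (.esc (.gadget i j.castSucc a))) ∧
    WeaklyLeft (M (.conn j c)) (fun a => M (.edge j a))
  /-- If `e_j = v_i v_i'` with `i < i'`, then `C_j^3` and `C_j^4` weakly intersect the gadget of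
  `v_i'` in region `j` to the right, and strongly intersect `E_j` to the left. -/
  conn34 : ∀ j i i', i < i' → (πE j : Sym2 V) = s(πV i, πV i') → ∀ c : Fin 4, c = 2 ∨ c = 3 →
    WeaklyRight (M (.conn j c)) (fun a => M (.esc (.gadget i' j.castSucc a))) ∧
    StronglyLeft (M (.conn j c)) (fun a => M (.edge j a))

/-! ### The parameters -/

/-- `q = 28 n³ + 1` -/
def paramQ (n : ℕ) : ℕ := 28 * n ^ 3 + 1

/-- `p = 2 q + 7 n` -/
def paramP (n : ℕ) : ℕ := 2 * paramQ n + 7 * n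

/-- `q' = 18 n³ + 1` -/
def paramQ' (n : ℕ) : ℕ := 18 * n ^ 3 + 1

/-- `p' = 2 q' + 5 n` -/
def paramP' (n : ℕ) : ℕ := 2 * paramQ' n + 5 * n

/-- The threshold `f(G, k)` for a cubic graph on `n` vertices. -/
def threshold (n k : ℕ) : ℚ :=
  let p : ℚ := paramP n
  let q : ℚ := paramQ n
  let p' : ℚ := paramP' n
  let q' : ℚ := paramQ' n
  (3 * n ^ 2 / 2 + n) * (2 * p * q + q ^ 2) + 3 * n / 2 * (2 * p' * q' + q' ^ 2)
    + 6 * n * q * (n + 1) + (3 * n ^ 2 + 3 * n) * (n - 1) * (p + q) + 3 * n ^ 2 * (p' + q')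
    + (3 * n * p' + 2 * k * q') + 4 * k

end IntervalMaxCut

open IntervalMaxCut

open IntervalMaxCut

namespace IntervalMaxCut

open GadgetIdx

/-! ### Closed intervals -/

/-! The lemma follows from two estimates with a common constant `baseValue` = B. A cut of G with c
edges yields a cut of the model with at least B + (2q' + 4)c edges (`le_cut`). No cut of the model
has more than B + 2q'·mc(G) + 6m(n+2)² edges (`cut_le`). The threshold is B + (2q' + 4)k, and
6m(n+2)² < 2q' (`join_edges_lt`), so it is out of reach when mc(G) < k.

The conditions do not prescribe the order of the gadgets on the line, but they force it up to
reflection. A link meets its two end gadgets and contains neither, so every other gadget it meets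
lies between them. This interleaves the regions (`sorted_of_interleaved`, `pos_lt_of_ahead`). Hence
it is known exactly how links and connections meet gadgets. Among themselves, links and connections
are only partly determined, which is why an error term remains.

A gadget has so many short intervals that it is best split as LS ∪ RL against LL ∪ RS, so that one
bit s describes it (`gadget_bound`). Covering intervals then gain p + q (or p' + q') on either side.
Links reward bits that alternate from region to region, so a vertex essentially makes one choice.
The connections at E_j gain an extra 2q' exactly when the bits of the two ends of e_j differ. Each
failure to alternate loses 2q, and a majority vote over the three edges at a vertex shows that it
gains at most 2q' ≤ 2q (`sum_differ_le_maxCut_add`). -/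

theorem meets_iff (I J : NonemptyInterval ℝ) : Meets I J ↔ I.fst ≤ J.snd ∧ J.fst ≤ I.snd := by
  have hI := I.fst_le_snd
  have hJ := J.fst_le_snd
  constructor
  · rintro ⟨x, hx, hy⟩
    rw [SetLike.mem_coe, NonemptyInterval.mem_def] at hx hy
    exact ⟨hx.1.trans hy.2, hy.1.trans hx.2⟩
  · rintro ⟨h1, h2⟩
    refine ⟨max I.fst J.fst, ?_, ?_⟩ <;> rw [SetLike.mem_coe, NonemptyInterval.mem_def]
    · exact ⟨le_max_left _ _, max_le hI h2⟩
    · exact ⟨le_max_right _ _, max_le h1 hJ⟩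

theorem meets_comm {I J : NonemptyInterval ℝ} : Meets I J ↔ Meets J I := by
  rw [meets_iff, meets_iff, and_comm]

theorem not_meets_iff (I J : NonemptyInterval ℝ) : ¬ Meets I J ↔ I.snd < J.fst ∨ J.snd < I.fst := by
  rw [meets_iff]
  grind

theorem Meets.of_subset {I J K : NonemptyInterval ℝ} (h : Meets I J) (hJ : (J : Set ℝ) ⊆ K) :
    Meets I K := by
  obtain ⟨x, hx, hy⟩ := h
  exact ⟨x, hx, hJ hy⟩

theorem subset_of_fst_le_of_snd_le {I J : NonemptyInterval ℝ} (h1 : I.fst ≤ J.fst)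
    (h2 : J.snd ≤ I.snd) : (J : Set ℝ) ⊆ I := by
  intro x hx
  rw [SetLike.mem_coe, NonemptyInterval.mem_def] at hx ⊢
  exact ⟨h1.trans hx.1, hx.2.trans h2⟩

theorem Meets.symm {I J : NonemptyInterval ℝ} (h : Meets I J) : Meets J I := meets_comm.1 h

theorem meets_of_subset {I J : NonemptyInterval ℝ} (hJ : (J : Set ℝ) ⊆ I) : Meets I J :=
  ⟨J.fst, hJ (NonemptyInterval.mem_def.2 ⟨le_rfl, J.fst_le_snd⟩),
    NonemptyInterval.mem_def.2 ⟨le_rfl, J.fst_le_snd⟩⟩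

/-! ### Families of pairwise disjoint connected blocks of intervals -/

/-- A set of intervals such that an interval disjoint from all of them lies on one side of all. -/
def OneSided (S : Set (NonemptyInterval ℝ)) : Prop :=
  ∀ J, (∀ a ∈ S, ¬ Meets a J) → (∀ a ∈ S, a.snd < J.fst) ∨ ∀ a ∈ S, J.snd < a.fst

/-- The intersection graph of a gadget with a long interval is connected, and the side of J on which
an interval lies passes along its edges. -/
theorem IsGrainedGadget.oneSided {x y : ℕ} (hy : 0 < y) {H : GadgetIdx x y → NonemptyInterval ℝ}
    (hH : IsGrainedGadget H) : OneSided (Set.range H) := by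
  intro J hJ
  have step : ∀ a b, Meets (H a) (H b) →
      ((H a).snd < J.fst → (H b).snd < J.fst) ∧ (J.snd < (H a).fst → J.snd < (H b).fst) := by
    intro a b hab
    have h1 := (not_meets_iff _ _).1 (hJ _ ⟨a, rfl⟩)
    have h2 := (not_meets_iff _ _).1 (hJ _ ⟨b, rfl⟩)
    rw [meets_iff] at hab
    have := J.fst_le_snd
    have := (H a).fst_le_snd
    have := (H b).fst_le_snd
    constructor <;> intro h <;> rcases h2 with h2 | h2 <;> linarith
  have reach : ∀ b, ((H (ll ⟨0, hy⟩)).snd < J.fst → (H b).snd < J.fst) ∧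
      (J.snd < (H (ll ⟨0, hy⟩)).fst → J.snd < (H b).fst) := by
    have hl : ∀ b ∈ (LL ∪ RL : Set (GadgetIdx x y)),
        ((H (ll ⟨0, hy⟩)).snd < J.fst → (H b).snd < J.fst) ∧
        (J.snd < (H (ll ⟨0, hy⟩)).fst → J.snd < (H b).fst) := fun b hb =>
      step _ _ (hH.long_meets _ (Or.inl ⟨_, rfl⟩) _ hb)
    rintro (a | a | a | a)
    · exact step _ _ ((hH.left_short (ls a) ⟨a, rfl⟩ _ (by simp)).2 ⟨_, rfl⟩).symm
    · exact hl _ (Or.inl ⟨a, rfl⟩)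
    · have h1 := hl (rl ⟨0, hy⟩) (Or.inr ⟨_, rfl⟩)
      have h2 := step (rl ⟨0, hy⟩) (rs a)
        ((hH.right_short (rs a) ⟨a, rfl⟩ _ (by simp)).2 ⟨_, rfl⟩).symm
      exact ⟨h2.1 ∘ h1.1, h2.2 ∘ h1.2⟩
    · exact hl _ (Or.inr ⟨a, rfl⟩)
  rcases (not_meets_iff _ _).1 (hJ _ ⟨ll ⟨0, hy⟩, rfl⟩) with h | h
  · left
    rintro _ ⟨b, rfl⟩
    exact (reach b).1 h
  · right
    rintro _ ⟨b, rfl⟩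
    exact (reach b).2 h

/-- Pairwise disjoint one-sided blocks of intervals, with a position for each block. -/
structure BlockFamily {Γ : Type*} (S : Γ → Set (NonemptyInterval ℝ)) (pos : Γ → ℝ) : Prop where
  oneSided : ∀ g, OneSided (S g)
  disjoint : ∀ g h, g ≠ h → ∀ a ∈ S g, ∀ b ∈ S h, ¬ Meets a b
  rep : ∀ g, ∃ a ∈ S g, a.fst = pos g

/-- `h` lies strictly between `g` and `g'`. -/
def Between {Γ : Type*} (pos : Γ → ℝ) (g h g' : Γ) : Prop :=
  (pos g < pos h ∧ pos h < pos g') ∨ (pos g' < pos h ∧ pos h < pos g)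

namespace BlockFamily

variable {Γ : Type*} {S : Γ → Set (NonemptyInterval ℝ)} {pos : Γ → ℝ}

/-- One-sidedness is applied twice: to block g against the representative of h, then to block h
against the given interval a. Comparing representatives thus compares whole blocks. -/
theorem lt_of_pos_lt (F : BlockFamily S pos) {g h : Γ} (hgh : pos g < pos h)
    {a b : NonemptyInterval ℝ} (ha : a ∈ S g) (hb : b ∈ S h) : a.snd < b.fst := by
  have hne : g ≠ h := by
    rintro rfl
    exact lt_irrefl _ hgh
  obtain ⟨u, hu, hu'⟩ := F.rep g
  obtain ⟨v, hv, hv'⟩ := F.rep h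
  have h1 := F.oneSided g v fun a ha => F.disjoint g h hne a ha v hv
  have h2 := F.oneSided h a fun b hb => F.disjoint h g hne.symm b hb a ha
  have hu1 := u.fst_le_snd
  have hv1 := v.fst_le_snd
  have ha1 := a.fst_le_snd
  rcases h1 with h1 | h1
  · rcases h2 with h2 | h2
    · have := h1 a ha
      have := h2 v hv
      linarith
    · exact h2 b hb
  · have := h1 u hu
    linarith

theorem pos_ne (F : BlockFamily S pos) {g h : Γ} (hne : g ≠ h) : pos g ≠ pos h := by
  intro he
  obtain ⟨u, hu, hu'⟩ := F.rep g
  obtain ⟨v, hv, hv'⟩ := F.rep h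
  refine F.disjoint g h hne u hu v hv ((meets_iff _ _).2 ⟨?_, ?_⟩)
  · have := v.fst_le_snd
    linarith
  · have := u.fst_le_snd
    linarith

/-- An interval that meets two blocks contains the blocks between them. -/
theorem subset_of_between (F : BlockFamily S pos) {g h g' : Γ} (H : Between pos g h g')
    {I a a' b : NonemptyInterval ℝ} (ha : a ∈ S g) (ha' : a' ∈ S g') (hb : b ∈ S h)
    (hIa : Meets I a) (hIa' : Meets I a') : (b : Set ℝ) ⊆ I := by
  rw [meets_iff] at hIa hIa'
  rcases H with ⟨h1, h2⟩ | ⟨h1, h2⟩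
  · have := F.lt_of_pos_lt h1 ha hb
    have := F.lt_of_pos_lt h2 hb ha'
    exact subset_of_fst_le_of_snd_le (by linarith) (by linarith)
  · have := F.lt_of_pos_lt h1 ha' hb
    have := F.lt_of_pos_lt h2 hb ha
    exact subset_of_fst_le_of_snd_le (by linarith) (by linarith)

/-- An interval that meets two blocks but neither of them completely meets no block that is not
between them. -/
theorem not_meets_of_not_between (F : BlockFamily S pos) {g h g' : Γ} (hgg' : g ≠ g') (hg : h ≠ g)
    (hg' : h ≠ g') (H : ¬ Between pos g h g') {I a a' b c c' : NonemptyInterval ℝ} (ha : a ∈ S g)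
    (ha' : a' ∈ S g') (hc : c ∈ S g) (hc' : c' ∈ S g') (hb : b ∈ S h) (hIa : Meets I a)
    (hIa' : Meets I a') (hIc : ¬ Meets I c) (hIc' : ¬ Meets I c') : ¬ Meets I b := by
  intro hIb
  have n1 := F.pos_ne hgg'
  have n2 := F.pos_ne hg
  have n3 := F.pos_ne hg'
  -- If h is not in the middle, one of the two end blocks is, and that block would be contained in
  -- I.
  have key : Between pos h g g' ∨ Between pos g g' h := by
    unfold Between at H ⊢
    grind
  rcases key with k | k
  · exact hIc (meets_of_subset (F.subset_of_between k hb ha' hc hIb hIa'))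
  · exact hIc' (meets_of_subset (F.subset_of_between k ha hb hc' hIa hIb))

/-- Two intervals that reach beyond an interval `c` on different sides and miss it are disjoint. -/
theorem not_meets_of_separated (F : BlockFamily S pos) {g h g' : Γ} (H : Between pos g h g')
    {I J a a' c : NonemptyInterval ℝ} (ha : a ∈ S g) (ha' : a' ∈ S g') (hc : c ∈ S h)
    (hIa : Meets I a) (hJa' : Meets J a') (hIc : ¬ Meets I c) (hJc : ¬ Meets J c) :
    ¬ Meets I J := by
  rw [not_meets_iff] at hIc hJc ⊢
  rw [meets_iff] at hIa hJa'
  have := I.fst_le_snd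
  have := J.fst_le_snd
  have := c.fst_le_snd
  have := a.fst_le_snd
  have := a'.fst_le_snd
  rcases H with ⟨h1, h2⟩ | ⟨h1, h2⟩
  · have := F.lt_of_pos_lt h1 ha hc
    have := F.lt_of_pos_lt h2 hc ha'
    rcases hIc with hIc | hIc <;> rcases hJc with hJc | hJc <;> first | linarith | (left; linarith)
  · have := F.lt_of_pos_lt h1 ha' hc
    have := F.lt_of_pos_lt h2 hc ha
    rcases hIc with hIc | hIc <;> rcases hJc with hJc | hJc <;> first | linarith | (right; linarith)

end BlockFamily

section

/-! ### The order of the blocks of a reduction model -/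

/-- If consecutive rows of a grid of reals interleave, then the grid is sorted row by row, and `z j`
separates the rows `j` and `j + 1`. -/
theorem sorted_of_interleaved {n m : ℕ} (hn : 2 ≤ n) (x : ℕ → ℕ → ℝ) (z : ℕ → ℝ)
    (h1 : ∀ i j, i + 1 < n → j < m → (x i j < x (i + 1) j ∧ x (i + 1) j < x i (j + 1)) ∨
      (x i (j + 1) < x (i + 1) j ∧ x (i + 1) j < x i j))
    (h2 : ∀ i j, i + 1 < n → j < m →
      (x (i + 1) j < x i (j + 1) ∧ x i (j + 1) < x (i + 1) (j + 1)) ∨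
      (x (i + 1) (j + 1) < x i (j + 1) ∧ x i (j + 1) < x (i + 1) j))
    (h3 : ∀ i j, i < n → j < m → (x i j < z j ∧ z j < x i (j + 1)) ∨
      (x i (j + 1) < z j ∧ z j < x i j))
    (h0 : x 0 0 < x 0 1) :
    (∀ i j, i + 1 < n → j < m → x i j < x (i + 1) j ∧ x i (j + 1) < x (i + 1) (j + 1)) ∧
    ∀ i j, i < n → j < m → x i j < z j ∧ z j < x i (j + 1) := by
  -- Within one region the direction passes from each vertex to the next.
  have row : ∀ j, j < m → x 0 j < x 0 (j + 1) → ∀ i, i < n → x i j < x i (j + 1) := by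
    intro j hj h i
    induction i with
    | zero => exact fun _ => h
    | succ i ih =>
      intro hi
      have := ih (by omega)
      have := h1 i j hi hj
      have := h2 i j hi hj
      grind
  -- The direction passes to the next region through vertex 1: x 0 (j+1) < x 1 (j+1) forces x 0
  -- (j+1) < x 0 (j+2). A single vertex would not suffice, whence `2 ≤ n`.
  have first : ∀ j, j < m → x 0 j < x 0 (j + 1) := by
    intro j
    induction j with
    | zero => exact fun _ => h0
    | succ j ih =>
      intro hj
      have := ih (by omega)
      have := h1 0 j (by omega) (by omega)
      have := h2 0 j (by omega) (by omega)
      have := h1 0 (j + 1) (by omega) (by omega)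
      grind
  constructor
  · intro i j hi hj
    have := row j hj (first j hj) i (by omega)
    have := h1 i j hi hj
    have := h2 i j hi hj
    grind
  · intro i j hi hj
    have := row j hj (first j hj) i (by omega)
    have := h3 i j hi hj
    grind

/-- Column n holds the gadgets of the edges. It closes every row except row m, which has no edge
gadget; a passage to a later row goes through it. -/
theorem lex_lt_of_sorted {n m : ℕ} (hn : 1 ≤ n) (w : ℕ → ℕ → ℝ)
    (h1 : ∀ i j, i + 1 < n → j ≤ m → w i j < w (i + 1) j)
    (h2 : ∀ i j, i < n → j < m → w i j < w n j)
    (h3 : ∀ i j, i < n → j < m → w n j < w i (j + 1))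
    {i j i' j' : ℕ} (hi : i < n ∨ i = n ∧ j < m) (hi' : i' < n ∨ i' = n ∧ j' < m) (hj' : j' ≤ m)
    (h : j < j' ∨ j = j' ∧ i < i') : w i j < w i' j' := by
  have row : ∀ j, j ≤ m → ∀ d i, i + d + 1 < n → w i j < w (i + d + 1) j := by
    intro j hj d
    induction d with
    | zero => exact fun i hi => h1 i j hi hj
    | succ d ih => exact fun i hi => (ih i (by omega)).trans (h1 _ j hi hj)
  have cross : ∀ j, j < m → ∀ d, j + d + 1 ≤ m → ∀ i, i < n → w n j < w i (j + d + 1) := by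
    intro j hj d
    induction d with
    | zero => exact fun _ i hi => h3 i j hi hj
    | succ d ih =>
      exact fun hd i hi => (ih (by omega) 0 (by omega)).trans
        ((h2 0 _ (by omega) (by omega)).trans (h3 i _ hi (by omega)))
  have toEnd : j < m → w i j ≤ w n j := by
    intro hj
    rcases hi with hi | ⟨rfl, -⟩
    · exact (h2 i j hi hj).le
    · exact le_rfl
  rcases h with h | ⟨rfl, h⟩
  · obtain ⟨d, rfl⟩ := Nat.exists_eq_add_of_lt h
    have hj : j < m := by omega
    rcases hi' with hi' | ⟨rfl, hm⟩
    · exact (toEnd hj).trans_lt (cross j hj d hj' i' hi')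
    · exact (toEnd hj).trans_lt
        ((cross j hj d hj' 0 (by omega)).trans (h2 0 _ (by omega) hm))
  · rcases hi' with hi' | ⟨rfl, hm⟩
    · obtain ⟨d, rfl⟩ := Nat.exists_eq_add_of_lt h
      exact row j hj' d i hi'
    · exact h2 i j (by omega) hm

/-- The blocks of a reduction model: the gadgets of the vertices and the gadgets of the edges. -/
abbrev BlockIdx (n m : ℕ) : Type := (Fin n × Fin (m + 1)) ⊕ Fin m

namespace BlockIdx

variable {n m : ℕ}

/-- The region of a block. -/
def row : BlockIdx n m → ℕ
  | .inl (_, j) => j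
  | .inr j => j

/-- The position of a block in its region. -/
def col : BlockIdx n m → ℕ
  | .inl (i, _) => i
  | .inr _ => n

/-- The lexicographic order of the blocks. -/
def Ahead (g h : BlockIdx n m) : Prop := g.row < h.row ∨ g.row = h.row ∧ g.col < h.col

end BlockIdx

variable {n m p q p' q' : ℕ}

/-- The intervals of a block. -/
def block (M : ModelIdx n m p q p' q' → NonemptyInterval ℝ) :
    BlockIdx n m → Set (NonemptyInterval ℝ)
  | .inl (i, j) => Set.range fun a => M (.esc (.gadget i j a))
  | .inr j => Set.range fun a => M (.edge j a)

/-- The left end of a distinguished interval of a block. -/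
def blockPos (M : ModelIdx n m p q p' q' → NonemptyInterval ℝ) (hq : 0 < q) (hq' : 0 < q') :
    BlockIdx n m → ℝ
  | .inl (i, j) => (M (.esc (.gadget i j (ll ⟨0, hq⟩)))).fst
  | .inr j => (M (.edge j (ll ⟨0, hq'⟩))).fst

section

variable {V : Type*} {G : SimpleGraph V} {πV : Fin n ≃ V} {πE : Fin m ≃ G.edgeSet}
  {M : ModelIdx n m p q p' q' → NonemptyInterval ℝ}

namespace IsReductionModel

theorem link_meets_edge (hM : IsReductionModel G πV πE M) (i : Fin n) (j j' : Fin m) (b : Fin 2)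
    (a : GadgetIdx p' q') : Meets (M (.esc (.link i j b))) (M (.edge j' a)) ↔ j = j' := by
  rw [hM.esc_meets_edge]
  constructor
  · rintro ⟨i', b', h⟩
    cases h
    rfl
  · rintro rfl
    exact ⟨i, b, rfl⟩

theorem not_gadget_meets_edge (hM : IsReductionModel G πV πE M) (i : Fin n) (j : Fin (m + 1))
    (j' : Fin m) (a : GadgetIdx p q) (a' : GadgetIdx p' q') :
    ¬ Meets (M (.esc (.gadget i j a))) (M (.edge j' a')) := by
  rw [hM.esc_meets_edge]
  rintro ⟨i', b', h⟩
  cases h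

/-- A link of region j contains E_j and meets no interval of any other edge gadget. -/
theorem not_edge_meets_edge (hM : IsReductionModel G πV πE M) (hn : 0 < n) {j j' : Fin m}
    (hj : j ≠ j') (a a' : GadgetIdx p' q') : ¬ Meets (M (.edge j a)) (M (.edge j' a')) := fun h =>
  hj ((hM.link_meets_edge ⟨0, hn⟩ j j' 0 a').1
    (h.symm.of_subset (hM.link_covers_edge ⟨0, hn⟩ j 0 a)).symm)

theorem blockFamily (hM : IsReductionModel G πV πE M) (hn : 0 < n) (hq : 0 < q) (hq' : 0 < q') :
    BlockFamily (block M) (blockPos M hq hq') where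
  oneSided := by
    rintro (⟨i, j⟩ | j)
    · exact (hM.escalator.grained i j).oneSided hq
    · exact (hM.grained j).oneSided hq'
  disjoint := by
    rintro (⟨i, j⟩ | j) (⟨i', j'⟩ | j') hne _ ⟨a, rfl⟩ _ ⟨a', rfl⟩
    · exact hM.escalator.disjoint i j i' j' (fun h => hne (congrArg _ h)) a a'
    · exact hM.not_gadget_meets_edge i j j' a a'
    · exact fun h => hM.not_gadget_meets_edge i' j' j a' a h.symm
    · exact hM.not_edge_meets_edge hn (fun h => hne (congrArg _ h)) a a'
  rep := by
    rintro (⟨i, j⟩ | j)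
    · exact ⟨_, ⟨_, rfl⟩, rfl⟩
    · exact ⟨_, ⟨_, rfl⟩, rfl⟩

theorem link_meets_rl (hM : IsReductionModel G πV πE M) (i : Fin n) (j : Fin m) (b : Fin 2)
    (a : Fin q) : Meets (M (.esc (.link i j b))) (M (.esc (.gadget i j.castSucc (rl a)))) :=
  (hM.escalator.link_right i j b _).2 ⟨a, rfl⟩

theorem link_meets_ll (hM : IsReductionModel G πV πE M) (i : Fin n) (j : Fin m) (b : Fin 2)
    (a : Fin q) : Meets (M (.esc (.link i j b))) (M (.esc (.gadget i j.succ (ll a)))) :=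
  (hM.escalator.link_left i j b _).2 ⟨a, rfl⟩

theorem not_link_meets_rs (hM : IsReductionModel G πV πE M) (i : Fin n) (j : Fin m) (b : Fin 2)
    (a : Fin p) : ¬ Meets (M (.esc (.link i j b))) (M (.esc (.gadget i j.castSucc (rs a)))) :=
  fun h => by simpa [RL] using (hM.escalator.link_right i j b _).1 h

theorem not_link_meets_ls (hM : IsReductionModel G πV πE M) (i : Fin n) (j : Fin m) (b : Fin 2)
    (a : Fin p) : ¬ Meets (M (.esc (.link i j b))) (M (.esc (.gadget i j.succ (ls a)))) :=
  fun h => by simpa [LL] using (hM.escalator.link_left i j b _).1 h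

/-- A block that meets a link and is not one of the two ends of the link is between them. -/
theorem between_of_link_meets (hM : IsReductionModel G πV πE M) (hn : 0 < n) (hp : 0 < p)
    (hq : 0 < q) (hq' : 0 < q') (i : Fin n) (j : Fin m) (b : Fin 2) (h : BlockIdx n m)
    (h1 : h ≠ .inl (i, j.castSucc)) (h2 : h ≠ .inl (i, j.succ)) {I : NonemptyInterval ℝ}
    (hI : I ∈ block M h) (hm : Meets (M (.esc (.link i j b))) I) :
    Between (blockPos M hq hq') (.inl (i, j.castSucc)) h (.inl (i, j.succ)) := by
  by_contra hb
  refine (hM.blockFamily hn hq hq').not_meets_of_not_between ?_ h1 h2 hb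
    ⟨rl ⟨0, hq⟩, rfl⟩ ⟨ll ⟨0, hq⟩, rfl⟩ ⟨rs ⟨0, hp⟩, rfl⟩ ⟨ls ⟨0, hp⟩, rfl⟩ hI
    (hM.link_meets_rl i j b _) (hM.link_meets_ll i j b _) (hM.not_link_meets_rs i j b _)
    (hM.not_link_meets_ls i j b _) hm
  simp [Fin.ext_iff]

/-- The conditions are invariant under reflection of the line, so the order is determined only up to
reversal; the first two gadgets of vertex 0 decide which case occurs. -/
theorem pos_lt_of_ahead (hM : IsReductionModel G πV πE M) (hn : 2 ≤ n) (hm : 0 < m) (hp : 0 < p)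
    (hq : 0 < q) (hq' : 0 < q') :
    (∀ g h : BlockIdx n m, g.Ahead h → blockPos M hq hq' g < blockPos M hq hq' h) ∨
    ∀ g h : BlockIdx n m, g.Ahead h → blockPos M hq hq' h < blockPos M hq hq' g := by
  set P := blockPos M hq hq'
  have hn0 : 0 < n := by omega
  -- The value 0 outside the grid is never used.
  let x : ℕ → ℕ → ℝ := fun i j =>
    if h : i < n ∧ j < m + 1 then P (.inl (⟨i, h.1⟩, ⟨j, h.2⟩)) else 0
  let z : ℕ → ℝ := fun j => if h : j < m then P (.inr ⟨j, h⟩) else 0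
  have hx : ∀ (i j : ℕ) (hi : i < n) (hj : j < m + 1), x i j = P (.inl (⟨i, hi⟩, ⟨j, hj⟩)) :=
    fun i j hi hj => dif_pos ⟨hi, hj⟩
  have hz : ∀ (j : ℕ) (hj : j < m), z j = P (.inr ⟨j, hj⟩) := fun j hj => dif_pos hj
  have h1 : ∀ i j, i + 1 < n → j < m → (x i j < x (i + 1) j ∧ x (i + 1) j < x i (j + 1)) ∨
      (x i (j + 1) < x (i + 1) j ∧ x (i + 1) j < x i j) := by
    intro i j hi hj
    rw [hx i j (by omega) (by omega), hx (i + 1) j hi (by omega), hx i (j + 1) (by omega) (by omega)]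
    refine hM.between_of_link_meets hn0 hp hq hq' ⟨i, by omega⟩ ⟨j, hj⟩ 0
      (.inl (⟨i + 1, hi⟩, ⟨j, by omega⟩)) (by simp) (by simp) ⟨ll ⟨0, hq⟩, rfl⟩
      (meets_of_subset (hM.escalator.link_covers_next ⟨i, by omega⟩ ⟨i + 1, hi⟩ rfl ⟨j, hj⟩ 0 _))
  have h2 : ∀ i j, i + 1 < n → j < m →
      (x (i + 1) j < x i (j + 1) ∧ x i (j + 1) < x (i + 1) (j + 1)) ∨
      (x (i + 1) (j + 1) < x i (j + 1) ∧ x i (j + 1) < x (i + 1) j) := by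
    intro i j hi hj
    rw [hx (i + 1) j hi (by omega), hx i (j + 1) (by omega) (by omega),
      hx (i + 1) (j + 1) hi (by omega)]
    refine hM.between_of_link_meets hn0 hp hq hq' ⟨i + 1, by omega⟩ ⟨j, hj⟩ 0
      (.inl (⟨i, by omega⟩, ⟨j + 1, by omega⟩)) (by simp) (by simp) ⟨ll ⟨0, hq⟩, rfl⟩
      (meets_of_subset (hM.escalator.link_covers_prev ⟨i, by omega⟩ ⟨i + 1, hi⟩ rfl ⟨j, hj⟩ 0 _))
  have h3 : ∀ i j, i < n → j < m → (x i j < z j ∧ z j < x i (j + 1)) ∨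
      (x i (j + 1) < z j ∧ z j < x i j) := by
    intro i j hi hj
    rw [hx i j hi (by omega), hz j hj, hx i (j + 1) hi (by omega)]
    exact hM.between_of_link_meets hn0 hp hq hq' ⟨i, hi⟩ ⟨j, hj⟩ 0 (.inr ⟨j, hj⟩) (by simp)
      (by simp) ⟨ll ⟨0, hq'⟩, rfl⟩ ((hM.link_meets_edge _ _ _ _ _).2 rfl)
  -- Stated for arbitrary grids so that it also applies to the negated positions in the reversed
  -- case.
  have finish : ∀ (u : ℕ → ℕ → ℝ) (v : ℕ → ℝ),
      ((∀ i j, i + 1 < n → j < m → u i j < u (i + 1) j ∧ u i (j + 1) < u (i + 1) (j + 1)) ∧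
        ∀ i j, i < n → j < m → u i j < v j ∧ v j < u i (j + 1)) →
      ∀ g h : BlockIdx n m, g.Ahead h →
        (if g.col < n then u g.col g.row else v g.row) <
          if h.col < n then u h.col h.row else v h.row := by
    rintro u v ⟨hu, hv⟩ g h hgh
    refine lex_lt_of_sorted (n := n) (m := m) (by omega)
      (fun i j => if i < n then u i j else v j) ?_ ?_ ?_ ?_ ?_ ?_ hgh
    · intro i j hi hj
      rw [if_pos (by omega), if_pos hi]
      rcases j with _ | j
      · exact (hu i 0 hi hm).1
      · exact (hu i j hi (by omega)).2
    · intro i j hi hj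
      rw [if_pos hi, if_neg (lt_irrefl _)]
      exact (hv i j hi hj).1
    · intro i j hi hj
      rw [if_pos hi, if_neg (lt_irrefl _)]
      exact (hv i j hi hj).2
    · rcases g with ⟨i, j⟩ | j
      · exact Or.inl i.2
      · exact Or.inr ⟨rfl, j.2⟩
    · rcases h with ⟨i, j⟩ | j
      · exact Or.inl i.2
      · exact Or.inr ⟨rfl, j.2⟩
    · rcases h with ⟨i, j⟩ | j
      · exact Nat.lt_succ_iff.1 j.2
      · exact j.2.le
  have hval : ∀ g : BlockIdx n m, (if g.col < n then x g.col g.row else z g.row) = P g := by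
    rintro (⟨i, j⟩ | j)
    · exact (if_pos i.2).trans (hx _ _ i.2 j.2)
    · exact (if_neg (lt_irrefl n)).trans (hz _ j.2)
  rcases lt_or_ge (x 0 0) (x 0 1) with h0 | h0
  · left
    intro g h hgh
    have := finish x z (sorted_of_interleaved hn x z h1 h2 h3 h0) g h hgh
    rwa [hval, hval] at this
  · right
    intro g h hgh
    have h0' : x 0 1 < x 0 0 := by
      have := h1 0 0 (by omega) hm
      grind
    have flip : ∀ {a b c : ℝ}, (a < b ∧ b < c) ∨ (c < b ∧ b < a) →
        (-a < -b ∧ -b < -c) ∨ (-c < -b ∧ -b < -a) := by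
      intro a b c habc
      simp only [neg_lt_neg_iff]
      tauto
    have := finish (fun i j => - x i j) (fun j => - z j)
      (sorted_of_interleaved hn (fun i j => - x i j) (fun j => - z j)
        (fun i j hi hj => flip (h1 i j hi hj))
        (fun i j hi hj => flip (h2 i j hi hj))
        (fun i j hi hj => flip (h3 i j hi hj))
        (neg_lt_neg h0')) g h hgh
    have hneg : ∀ g : BlockIdx n m,
        (if g.col < n then - x g.col g.row else - z g.row) = - P g := by
      intro g
      rw [← hval g]
      split_ifs <;> rfl
    simpa only [hneg, neg_lt_neg_iff] using this

end IsReductionModel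

end

end

section

/-! ### The intersections of a reduction model -/

variable {n m p q p' q' : ℕ}

section

variable {V : Type*} {G : SimpleGraph V} {πV : Fin n ≃ V} {πE : Fin m ≃ G.edgeSet}
  {M : ModelIdx n m p q p' q' → NonemptyInterval ℝ}

/-- `lo j` and `hi j` are the numbers of the ends of the edge number `j`, in increasing order. -/
def AreEnds (πV : Fin n ≃ V) (πE : Fin m ≃ G.edgeSet) (lo hi : Fin m → Fin n) : Prop :=
  ∀ j, lo j < hi j ∧ (πE j : Sym2 V) = s(πV (lo j), πV (hi j))

theorem exists_areEnds (πV : Fin n ≃ V) (πE : Fin m ≃ G.edgeSet) :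
    ∃ lo hi : Fin m → Fin n, AreEnds πV πE lo hi := by
  have h : ∀ j, ∃ i i' : Fin n, i < i' ∧ (πE j : Sym2 V) = s(πV i, πV i') := by
    intro j
    obtain ⟨e, he⟩ := πE j
    induction e using Sym2.ind with
    | _ u v =>
      have hne : u ≠ v := G.ne_of_adj he
      rcases lt_trichotomy (πV.symm u) (πV.symm v) with h | h | h
      · exact ⟨_, _, h, by simp⟩
      · exact absurd (πV.symm.injective h) hne
      · exact ⟨_, _, h, by simp [Sym2.eq_swap]⟩
  choose lo hi h using h
  exact ⟨lo, hi, h⟩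

/-- The number of the vertex whose gadget the interval `conn j c` weakly intersects. -/
def connEnd (lo hi : Fin m → Fin n) (j : Fin m) (c : Fin 4) : Fin n :=
  if c = 0 ∨ c = 1 then lo j else hi j

/-- The intervals that join gadgets: the links and the connections to the gadgets of the edges. -/
abbrev JoinIdx (n m : ℕ) : Type := (Fin n × Fin m × Fin 2) ⊕ (Fin m × Fin 4)

namespace JoinIdx

/-- The name of a joining interval in the model. -/
def toModel (p q p' q' : ℕ) : JoinIdx n m → ModelIdx n m p q p' q'
  | .inl (i, j, b) => .esc (.link i j b)
  | .inr (j, c) => .conn j c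

/-- The region of a joining interval. -/
def region : JoinIdx n m → Fin m
  | .inl (_, j, _) => j
  | .inr (j, _) => j

/-- The vertex at whose gadget a joining interval starts. -/
def start (lo hi : Fin m → Fin n) : JoinIdx n m → Fin n
  | .inl (i, _, _) => i
  | .inr (j, c) => connEnd lo hi j c

end JoinIdx

/-- The size of the parameters that makes the order of the blocks unique. -/
structure IsLarge (n m p q q' : ℕ) : Prop where
  two_le : 2 ≤ n
  m_pos : 0 < m
  p_pos : 0 < p
  q_pos : 0 < q
  q'_pos : 0 < q'

namespace IsReductionModel

theorem between_of_ahead (hM : IsReductionModel G πV πE M) (hl : IsLarge n m p q q')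
    {g h g' : BlockIdx n m} (h1 : g.Ahead h) (h2 : h.Ahead g') :
    Between (blockPos M hl.q_pos hl.q'_pos) g h g' := by
  rcases hM.pos_lt_of_ahead hl.two_le hl.m_pos hl.p_pos hl.q_pos hl.q'_pos with H | H
  · exact Or.inl ⟨H _ _ h1, H _ _ h2⟩
  · exact Or.inr ⟨H _ _ h2, H _ _ h1⟩

theorem not_between_of_ahead (hM : IsReductionModel G πV πE M) (hl : IsLarge n m p q q')
    {g h g' : BlockIdx n m} (hg : g.Ahead g') (h' : h.Ahead g ∨ g'.Ahead h) :
    ¬ Between (blockPos M hl.q_pos hl.q'_pos) g h g' := by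
  unfold Between
  rcases hM.pos_lt_of_ahead hl.two_le hl.m_pos hl.p_pos hl.q_pos hl.q'_pos with H | H
  · have := H _ _ hg
    rcases h' with h | h <;> have := H _ _ h <;> grind
  · have := H _ _ hg
    rcases h' with h | h <;> have := H _ _ h <;> grind

/-- Between the two ends of a link lie the gadgets of larger vertices in its region and of smaller
vertices in the next one. These are contained in the link, and all others outside its ends are
missed. -/
theorem link_meets_gadget (hM : IsReductionModel G πV πE M) (hl : IsLarge n m p q q')
    (i : Fin n) (j : Fin m) (b : Fin 2) (i' : Fin n) (j' : Fin (m + 1)) (a : GadgetIdx p q) :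
    Meets (M (.esc (.link i j b))) (M (.esc (.gadget i' j' a))) ↔
      (j' = j.castSucc ∧ (i < i' ∨ i = i' ∧ a ∈ RL)) ∨
      (j' = j.succ ∧ (i' < i ∨ i = i' ∧ a ∈ LL)) := by
  have hn0 : 0 < n := by have := hl.two_le; omega
  by_cases e1 : (i', j') = (i, j.castSucc)
  · obtain ⟨rfl, rfl⟩ := Prod.mk.inj e1
    rw [hM.escalator.link_right i' j b a]
    simp [Fin.ext_iff]
  by_cases e2 : (i', j') = (i, j.succ)
  · obtain ⟨rfl, rfl⟩ := Prod.mk.inj e2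
    rw [hM.escalator.link_left i' j b a]
    simp [Fin.ext_iff]
  have hne : i = i' → j' ≠ j.castSucc ∧ j' ≠ j.succ := by
    rintro rfl
    exact ⟨fun h => e1 (by rw [h]), fun h => e2 (by rw [h])⟩
  have F := hM.blockFamily hn0 hl.q_pos hl.q'_pos
  have hgg : BlockIdx.Ahead (.inl (i, j.castSucc) : BlockIdx n m) (.inl (i, j.succ)) := by
    left
    simp [BlockIdx.row]
  by_cases hb : (j' = j.castSucc ∧ i < i') ∨ (j' = j.succ ∧ i' < i)
  · refine iff_of_true ?_ (by tauto)
    refine meets_of_subset (F.subset_of_between (g := .inl (i, j.castSucc)) (h := .inl (i', j'))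
      (g' := .inl (i, j.succ)) (hM.between_of_ahead hl ?_ ?_) ⟨rl ⟨0, hl.q_pos⟩, rfl⟩
      ⟨ll ⟨0, hl.q_pos⟩, rfl⟩ ⟨a, rfl⟩ (hM.link_meets_rl i j b _) (hM.link_meets_ll i j b _))
    all_goals
      simp only [BlockIdx.Ahead, BlockIdx.row, BlockIdx.col]
      simp only [Fin.lt_def, Fin.ext_iff, Fin.val_succ, Fin.val_castSucc] at hb ⊢
      omega
  · refine iff_of_false ?_ (by tauto)
    refine F.not_meets_of_not_between (g := .inl (i, j.castSucc)) (h := .inl (i', j'))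
      (g' := .inl (i, j.succ)) (by simp [Fin.ext_iff]) (fun h => e1 (Sum.inl.inj h))
      (fun h => e2 (Sum.inl.inj h)) (hM.not_between_of_ahead hl hgg ?_)
      ⟨rl ⟨0, hl.q_pos⟩, rfl⟩ ⟨ll ⟨0, hl.q_pos⟩, rfl⟩ ⟨rs ⟨0, hl.p_pos⟩, rfl⟩
      ⟨ls ⟨0, hl.p_pos⟩, rfl⟩ ⟨a, rfl⟩ (hM.link_meets_rl i j b _) (hM.link_meets_ll i j b _)
      (hM.not_link_meets_rs i j b _) (hM.not_link_meets_ls i j b _)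
    simp only [BlockIdx.Ahead, BlockIdx.row, BlockIdx.col]
    simp only [Fin.lt_def, Fin.ext_iff, Fin.val_succ, Fin.val_castSucc, Ne] at hb hne ⊢
    omega

/-! ### Connections between vertex gadgets and edge gadgets -/

section

variable {lo hi : Fin m → Fin n}

theorem conn_weaklyRight (hM : IsReductionModel G πV πE M) (hE : AreEnds πV πE lo hi)
    (j : Fin m) (c : Fin 4) : WeaklyRight (M (.conn j c))
      fun a => M (.esc (.gadget (connEnd lo hi j c) j.castSucc a)) := by
  unfold connEnd
  split_ifs with h
  · exact (hM.conn12 j _ _ (hE j).1 (hE j).2 c h).1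
  · exact (hM.conn34 j _ _ (hE j).1 (hE j).2 c (by omega)).1

theorem conn_meets_edge_self (hM : IsReductionModel G πV πE M) (hE : AreEnds πV πE lo hi)
    (j : Fin m) (c : Fin 4) (a : GadgetIdx p' q') :
    Meets (M (.conn j c)) (M (.edge j a)) ↔ a ∈ LL ∨ ¬ (c = 0 ∨ c = 1) ∧ a ∈ LS := by
  by_cases h : c = 0 ∨ c = 1
  · rw [(hM.conn12 j _ _ (hE j).1 (hE j).2 c h).2 a]
    tauto
  · rw [(hM.conn34 j _ _ (hE j).1 (hE j).2 c (by omega)).2 a, Set.mem_union]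
    tauto

theorem conn_meets_rl (hM : IsReductionModel G πV πE M) (hE : AreEnds πV πE lo hi)
    (j : Fin m) (c : Fin 4) (a : Fin q) :
    Meets (M (.conn j c)) (M (.esc (.gadget (connEnd lo hi j c) j.castSucc (rl a)))) :=
  (hM.conn_weaklyRight hE j c _).2 ⟨a, rfl⟩

theorem not_conn_meets_rs (hM : IsReductionModel G πV πE M) (hE : AreEnds πV πE lo hi)
    (j : Fin m) (c : Fin 4) (a : Fin p) :
    ¬ Meets (M (.conn j c)) (M (.esc (.gadget (connEnd lo hi j c) j.castSucc (rs a)))) :=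
  fun h => by simpa [RL] using (hM.conn_weaklyRight hE j c _).1 h

theorem conn_meets_edge_ll (hM : IsReductionModel G πV πE M) (hE : AreEnds πV πE lo hi)
    (j : Fin m) (c : Fin 4) (a : Fin q') : Meets (M (.conn j c)) (M (.edge j (ll a))) :=
  (hM.conn_meets_edge_self hE j c _).2 (Or.inl ⟨a, rfl⟩)

theorem not_conn_meets_edge_rl (hM : IsReductionModel G πV πE M) (hE : AreEnds πV πE lo hi)
    (j : Fin m) (c : Fin 4) (a : Fin q') : ¬ Meets (M (.conn j c)) (M (.edge j (rl a))) :=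
  fun h => by simpa [LL, LS] using (hM.conn_meets_edge_self hE j c _).1 h

theorem ahead_conn (j : Fin m) (i : Fin n) :
    BlockIdx.Ahead (.inl (i, j.castSucc) : BlockIdx n m) (.inr j) :=
  Or.inr ⟨rfl, i.2⟩

theorem subset_conn (hM : IsReductionModel G πV πE M) (hl : IsLarge n m p q q')
    (hE : AreEnds πV πE lo hi) (j : Fin m) (c : Fin 4) (i' : Fin n)
    (hi' : connEnd lo hi j c < i') (a : GadgetIdx p q) :
    (M (.esc (.gadget i' j.castSucc a)) : Set ℝ) ⊆ M (.conn j c) := by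
  have hn0 : 0 < n := by have := hl.two_le; omega
  exact (hM.blockFamily hn0 hl.q_pos hl.q'_pos).subset_of_between
    (g := .inl (connEnd lo hi j c, j.castSucc)) (h := .inl (i', j.castSucc)) (g' := .inr j)
    (hM.between_of_ahead hl (Or.inr ⟨rfl, hi'⟩) (ahead_conn j i'))
    ⟨rl ⟨0, hl.q_pos⟩, rfl⟩ ⟨ll ⟨0, hl.q'_pos⟩, rfl⟩ ⟨a, rfl⟩ (hM.conn_meets_rl hE j c _)
    (hM.conn_meets_edge_ll hE j c _)

/-- A connection misses the right short intervals at its start and the right long intervals of E_j,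
so it contains neither end and cannot reach past them. -/
theorem not_conn_meets_of_ahead (hM : IsReductionModel G πV πE M) (hl : IsLarge n m p q q')
    (hE : AreEnds πV πE lo hi) (j : Fin m) (c : Fin 4) (h : BlockIdx n m)
    (h1 : h ≠ .inl (connEnd lo hi j c, j.castSucc)) (h2 : h ≠ .inr j)
    (h3 : h.Ahead (.inl (connEnd lo hi j c, j.castSucc)) ∨ BlockIdx.Ahead (.inr j) h)
    {I : NonemptyInterval ℝ} (hI : I ∈ block M h) : ¬ Meets (M (.conn j c)) I := by
  have hn0 : 0 < n := by have := hl.two_le; omega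
  exact (hM.blockFamily hn0 hl.q_pos hl.q'_pos).not_meets_of_not_between (by simp) h1 h2
    (hM.not_between_of_ahead hl (ahead_conn j _) h3)
    ⟨rl ⟨0, hl.q_pos⟩, rfl⟩ ⟨ll ⟨0, hl.q'_pos⟩, rfl⟩ ⟨rs ⟨0, hl.p_pos⟩, rfl⟩
    ⟨rl ⟨0, hl.q'_pos⟩, rfl⟩ hI (hM.conn_meets_rl hE j c _) (hM.conn_meets_edge_ll hE j c _)
    (hM.not_conn_meets_rs hE j c _) (hM.not_conn_meets_edge_rl hE j c _)

theorem conn_meets_gadget (hM : IsReductionModel G πV πE M) (hl : IsLarge n m p q q')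
    (hE : AreEnds πV πE lo hi) (j : Fin m) (c : Fin 4) (i' : Fin n) (j' : Fin (m + 1))
    (a : GadgetIdx p q) :
    Meets (M (.conn j c)) (M (.esc (.gadget i' j' a))) ↔
      j' = j.castSucc ∧ (connEnd lo hi j c < i' ∨ connEnd lo hi j c = i' ∧ a ∈ RL) := by
  by_cases e1 : (i', j') = (connEnd lo hi j c, j.castSucc)
  · obtain ⟨rfl, rfl⟩ := Prod.mk.inj e1
    rw [hM.conn_weaklyRight hE j c a]
    simp
  have hne : connEnd lo hi j c = i' → j' ≠ j.castSucc := by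
    rintro rfl h
    exact e1 (by rw [h])
  by_cases hb : j' = j.castSucc ∧ connEnd lo hi j c < i'
  · refine iff_of_true ?_ (by tauto)
    obtain ⟨rfl, hb⟩ := hb
    exact meets_of_subset (hM.subset_conn hl hE j c i' hb a)
  · refine iff_of_false ?_ (by tauto)
    refine hM.not_conn_meets_of_ahead hl hE j c (.inl (i', j')) (fun h => e1 (Sum.inl.inj h))
      (by simp) ?_ ⟨a, rfl⟩
    have := i'.2
    simp only [BlockIdx.Ahead, BlockIdx.row, BlockIdx.col]
    simp only [Fin.lt_def, Fin.ext_iff, Fin.val_castSucc, Ne] at hb hne ⊢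
    omega

theorem conn_meets_edge (hM : IsReductionModel G πV πE M) (hl : IsLarge n m p q q')
    (hE : AreEnds πV πE lo hi) (j : Fin m) (c : Fin 4) (j' : Fin m) (a : GadgetIdx p' q') :
    Meets (M (.conn j c)) (M (.edge j' a)) ↔
      j = j' ∧ (a ∈ LL ∨ ¬ (c = 0 ∨ c = 1) ∧ a ∈ LS) := by
  by_cases h : j = j'
  · subst h
    rw [hM.conn_meets_edge_self hE]
    simp
  · refine iff_of_false ?_ (by tauto)
    refine hM.not_conn_meets_of_ahead hl hE j c (.inr j') (by simp)
      (fun e => h (Sum.inr.inj e).symm) ?_ ⟨a, rfl⟩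
    simp only [BlockIdx.Ahead, BlockIdx.row, BlockIdx.col]
    simp only [Fin.ext_iff, Fin.val_castSucc] at h ⊢
    omega

/-- Since `lo j < hi j`, the connections from the smaller end contain the gadget of the larger end,
where the other two connections start. -/
theorem conn_meets_conn (hM : IsReductionModel G πV πE M) (hl : IsLarge n m p q q')
    (hE : AreEnds πV πE lo hi) (j : Fin m) {c c' : Fin 4} (hc : c = 0 ∨ c = 1)
    (hc' : ¬ (c' = 0 ∨ c' = 1)) : Meets (M (.conn j c)) (M (.conn j c')) := by
  refine ((hM.conn_meets_rl hE j c' ⟨0, hl.q_pos⟩).of_subset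
    (hM.subset_conn hl hE j c (connEnd lo hi j c') ?_ _)).symm
  rw [connEnd, connEnd, if_pos hc, if_neg hc']
  exact (hE j).1

theorem join_meets_start (hM : IsReductionModel G πV πE M) (hE : AreEnds πV πE lo hi)
    (κ : JoinIdx n m) (a : Fin q) : Meets (M (κ.toModel p q p' q'))
      (M (.esc (.gadget (κ.start lo hi) κ.region.castSucc (rl a)))) := by
  rcases κ with ⟨i, j, b⟩ | ⟨j, c⟩
  · exact hM.link_meets_rl i j b a
  · exact hM.conn_meets_rl hE j c a

/-- Supplies the separator for `not_join_meets_join`: a left short interval in the region after κ,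
which neither κ nor a joining interval of a later region reaches. -/
theorem not_join_meets (hM : IsReductionModel G πV πE M) (hl : IsLarge n m p q q')
    (hE : AreEnds πV πE lo hi) (κ : JoinIdx n m) (i : Fin n) (j : Fin (m + 1)) (a : Fin p)
    (hj : (κ.start lo hi = i ∧ j = κ.region.succ) ∨ (j : ℕ) < κ.region) :
    ¬ Meets (M (κ.toModel p q p' q')) (M (.esc (.gadget i j (ls a)))) := by
  rcases κ with ⟨i', j', b⟩ | ⟨j', c⟩
  · simp only [JoinIdx.toModel, JoinIdx.region, JoinIdx.start] at hj ⊢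
    rw [hM.link_meets_gadget hl]
    simp only [LL, RL, Set.mem_range, reduceCtorEq, exists_false, and_false, or_false,
      Fin.lt_def, Fin.ext_iff, Fin.val_castSucc, Fin.val_succ] at hj ⊢
    omega
  · simp only [JoinIdx.toModel, JoinIdx.region, JoinIdx.start] at hj ⊢
    rw [hM.conn_meets_gadget hl hE]
    simp only [RL, Set.mem_range, reduceCtorEq, exists_false, and_false, or_false,
      Fin.lt_def, Fin.ext_iff, Fin.val_castSucc, Fin.val_succ] at hj ⊢
    omega

/-- Joining intervals of regions that are not consecutive are disjoint. -/
theorem not_join_meets_join (hM : IsReductionModel G πV πE M) (hl : IsLarge n m p q q')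
    (hE : AreEnds πV πE lo hi) {κ κ' : JoinIdx n m} (h : (κ.region : ℕ) + 1 < κ'.region) :
    ¬ Meets (M (κ.toModel p q p' q')) (M (κ'.toModel p q p' q')) := by
  have hn0 : 0 < n := by have := hl.two_le; omega
  refine (hM.blockFamily hn0 hl.q_pos hl.q'_pos).not_meets_of_separated
    (g := .inl (κ.start lo hi, κ.region.castSucc)) (h := .inl (κ.start lo hi, κ.region.succ))
    (g' := .inl (κ'.start lo hi, κ'.region.castSucc))
    (hM.between_of_ahead hl (Or.inl ?_) (Or.inl ?_)) ⟨rl ⟨0, hl.q_pos⟩, rfl⟩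
    ⟨rl ⟨0, hl.q_pos⟩, rfl⟩ ⟨ls ⟨0, hl.p_pos⟩, rfl⟩ (hM.join_meets_start hE κ _)
    (hM.join_meets_start hE κ' _) (hM.not_join_meets hl hE κ _ _ _ (Or.inl ⟨rfl, rfl⟩))
    (hM.not_join_meets hl hE κ' _ _ _ (Or.inr ?_))
  · simp [BlockIdx.row]
  · simpa [BlockIdx.row] using h
  · simpa using h

end

end IsReductionModel

end

end

/-! ### Counting cut edges -/

/-- The contribution of the ordered pair `(u, v)` to the cut whose first part has the indicator
function `α`. -/
noncomputable def cutTerm {ι : Type*} (M : ι → NonemptyInterval ℝ) (α : ι → ℤ) (u v : ι) : ℤ :=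
  open Classical in if Meets (M u) (M v) then α u * (1 - α v) else 0

/-- The function `α` is an indicator function. -/
def IsIndicator {ι : Type*} (α : ι → ℤ) : Prop := ∀ u, α u = 0 ∨ α u = 1

open Classical in
theorem ncard_cutSet {ι : Type*} [Fintype ι] (G : SimpleGraph ι) (A : Set ι) :
    (cutSet G A).ncard = (Finset.univ.filter fun e : ι × ι =>
      G.Adj e.1 e.2 ∧ e.1 ∈ A ∧ e.2 ∉ A).card := by
  have h : cutSet G A = (fun e : ι × ι => s(e.1, e.2)) ''
      ((Finset.univ.filter fun e : ι × ι => G.Adj e.1 e.2 ∧ e.1 ∈ A ∧ e.2 ∉ A) : Set (ι × ι)) := by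
    ext e
    simp only [cutSet, Set.mem_ofPred_eq, Set.mem_compl_iff, Finset.coe_filter, Finset.mem_univ,
      true_and, Set.mem_image, Prod.exists]
    constructor
    · rintro ⟨he, u, hu, v, hv, rfl⟩
      exact ⟨u, v, ⟨he, hu, hv⟩, rfl⟩
    · rintro ⟨u, v, ⟨he, hu, hv⟩, rfl⟩
      exact ⟨he, u, hu, v, hv, rfl⟩
  rw [h, Set.InjOn.ncard_image, Set.ncard_coe_finset]
  rintro ⟨u, v⟩ h1 ⟨u', v'⟩ h2 he
  simp only [Finset.coe_filter, Finset.mem_univ, true_and, Set.mem_ofPred_eq] at h1 h2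
  rcases Sym2.eq_iff.1 he with ⟨rfl, rfl⟩ | ⟨rfl, rfl⟩
  · rfl
  · exact absurd h1.2.1 h2.2.2

open Classical in
theorem ncard_cutSet_eq_sum {ι : Type*} [Fintype ι] (G : SimpleGraph ι) (A : Set ι) :
    ((cutSet G A).ncard : ℤ) = ∑ u, ∑ v, if G.Adj u v ∧ u ∈ A ∧ v ∉ A then 1 else 0 := by
  rw [ncard_cutSet, Finset.card_filter, Fintype.sum_prod_type]
  push_cast
  rfl

open Classical in
theorem ncard_cutSet_intersectionGraph {ι : Type*} [Fintype ι] (M : ι → NonemptyInterval ℝ)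
    (A : Set ι) : ((cutSet (intersectionGraph M) A).ncard : ℤ) =
      ∑ u, ∑ v, cutTerm M (fun u => if u ∈ A then 1 else 0) u v := by
  rw [ncard_cutSet_eq_sum]
  refine Finset.sum_congr rfl fun u _ => Finset.sum_congr rfl fun v _ => ?_
  unfold cutTerm
  have hadj : (intersectionGraph M).Adj u v ↔ u ≠ v ∧ Meets (M u) (M v) := Iff.rfl
  rw [hadj]
  by_cases hm : Meets (M u) (M v) <;> by_cases hu : u ∈ A <;> by_cases hv : v ∈ A <;>
    simp [hm, hu, hv]
  -- An interval meets itself, but a diagonal term vanishes because u cannot be on both sides.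
  rintro rfl
  exact hv hu

theorem ncard_cutSet_of_isIndicator {ι : Type*} [Fintype ι] (M : ι → NonemptyInterval ℝ)
    {α : ι → ℤ} (hα : IsIndicator α) :
    ((cutSet (intersectionGraph M) {u | α u = 1}).ncard : ℤ) = ∑ u, ∑ v, cutTerm M α u v := by
  rw [ncard_cutSet_intersectionGraph]
  congr! 6 with u _ v _ w
  rcases hα w with h | h <;> simp [h]

theorem ncard_cutSet_le_maxCut {V : Type*} [Finite V] (G : SimpleGraph V) (A : Set V) :
    (cutSet G A).ncard ≤ maxCut G :=
  le_ciSup (f := fun A => (cutSet G A).ncard) (Set.finite_range _).bddAbove A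

theorem maxCut_of_isEmpty {V : Type*} [IsEmpty V] (G : SimpleGraph V) : maxCut G = 0 := by
  unfold maxCut
  have h : ∀ A : Set V, (cutSet G A).ncard = 0 := fun A => by
    rw [Set.eq_empty_of_forall_notMem (s := cutSet G A) fun e he => isEmptyElim he.2.choose,
      Set.ncard_empty]
  simp [h]

theorem le_maxCut_iff {V : Type*} [Finite V] (G : SimpleGraph V) {k : ℕ} (hk : 0 < k) :
    k ≤ maxCut G ↔ ∃ A : Set V, k ≤ (cutSet G A).ncard := by
  constructor
  · intro h
    -- For k = 0 the truncated k - 1 would not be smaller than the maximum; here positivity of k is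
    -- needed.
    obtain ⟨A, hA⟩ := exists_lt_of_lt_ciSup (show k - 1 < maxCut G by omega)
    exact ⟨A, by omega⟩
  · rintro ⟨A, hA⟩
    exact hA.trans (ncard_cutSet_le_maxCut G A)

/-! ### The value of a grained gadget -/

theorem sum_gadgetIdx {x y : ℕ} (f : GadgetIdx x y → ℤ) :
    ∑ a, f a = ∑ a, f (ls a) + ∑ a, f (ll a) + ∑ a, f (rs a) + ∑ a, f (rl a) := by
  let e : Fin x ⊕ Fin y ⊕ Fin x ⊕ Fin y ≃ GadgetIdx x y :=
    { toFun := Sum.elim ls (Sum.elim ll (Sum.elim rs rl))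
      invFun := fun a => match a with
        | ls a => .inl a
        | ll a => .inr (.inl a)
        | rs a => .inr (.inr (.inl a))
        | rl a => .inr (.inr (.inr a))
      left_inv := by rintro (a | a | a | a) <;> rfl
      right_inv := by rintro (a | a | a | a) <;> rfl }
  rw [← e.sum_comp]
  simp only [Fintype.sum_sum_type, ← add_assoc]
  rfl

/-- `1` if the sides `a` and `b` are different, and `0` otherwise. -/
def differ (a b : ℤ) : ℤ := a * (1 - b) + (1 - a) * b

section

variable {ι : Type*} {M : ι → NonemptyInterval ℝ} {α : ι → ℤ} {x y : ℕ} {H : GadgetIdx x y → ι}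

/-- The number of cut edges inside a grained gadget. -/
theorem sum_cutTerm_gadget (hα : IsIndicator α) (hH : IsGrainedGadget fun a => M (H a)) :
    ∑ a, ∑ b, cutTerm M α (H a) (H b) =
      (∑ a, α (H (ls a))) * (y - ∑ a, α (H (ll a))) +
      (∑ a, α (H (ll a))) * (x - ∑ a, α (H (ls a))) +
      (∑ a, α (H (rs a))) * (y - ∑ a, α (H (rl a))) +
      (∑ a, α (H (rl a))) * (x - ∑ a, α (H (rs a))) +
      (∑ a, α (H (ll a)) + ∑ a, α (H (rl a))) *
        (2 * y - ∑ a, α (H (ll a)) - ∑ a, α (H (rl a))) := by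
  have hz : ∀ u, α u * (1 - α u) = 0 := fun u => by rcases hα u with h | h <;> simp [h]
  have h0 : ∀ a b, (a ≠ b → ¬ Meets (M (H a)) (M (H b))) → cutTerm M α (H a) (H b) = 0 := by
    intro a b h
    unfold cutTerm
    split_ifs with hm
    · obtain rfl : a = b := by
        by_contra hne
        exact h hne hm
      exact hz _
    · rfl
  have h1 : ∀ a b, Meets (M (H a)) (M (H b)) →
      cutTerm M α (H a) (H b) = α (H a) * (1 - α (H b)) := fun a b h => if_pos h
  have L := hH.left_short
  have R := hH.right_short
  have lsls : ∀ a b, cutTerm M α (H (ls a)) (H (ls b)) = 0 := fun a b => h0 _ _ fun hne hm => by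
    simpa [LL] using (L _ ⟨a, rfl⟩ _ hne.symm).1 hm
  have lsrs : ∀ a b, cutTerm M α (H (ls a)) (H (rs b)) = 0 := fun a b => h0 _ _ fun hne hm => by
    simpa [LL] using (L _ ⟨a, rfl⟩ _ hne.symm).1 hm
  have lsrl : ∀ a b, cutTerm M α (H (ls a)) (H (rl b)) = 0 := fun a b => h0 _ _ fun hne hm => by
    simpa [LL] using (L _ ⟨a, rfl⟩ _ hne.symm).1 hm
  have rsls : ∀ a b, cutTerm M α (H (rs a)) (H (ls b)) = 0 := fun a b => h0 _ _ fun hne hm => by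
    simpa [RL] using (R _ ⟨a, rfl⟩ _ hne.symm).1 hm
  have rsrs : ∀ a b, cutTerm M α (H (rs a)) (H (rs b)) = 0 := fun a b => h0 _ _ fun hne hm => by
    simpa [RL] using (R _ ⟨a, rfl⟩ _ hne.symm).1 hm
  have rsll : ∀ a b, cutTerm M α (H (rs a)) (H (ll b)) = 0 := fun a b => h0 _ _ fun hne hm => by
    simpa [RL] using (R _ ⟨a, rfl⟩ _ hne.symm).1 hm
  have rlls : ∀ a b, cutTerm M α (H (rl a)) (H (ls b)) = 0 := fun a b => h0 _ _ fun hne hm => by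
    simpa [LL] using (L _ ⟨b, rfl⟩ _ hne).1 hm.symm
  have llrs : ∀ a b, cutTerm M α (H (ll a)) (H (rs b)) = 0 := fun a b => h0 _ _ fun hne hm => by
    simpa [RL] using (R _ ⟨b, rfl⟩ _ hne).1 hm.symm
  have lsll : ∀ a b, cutTerm M α (H (ls a)) (H (ll b)) = α (H (ls a)) * (1 - α (H (ll b))) :=
    fun a b => h1 _ _ ((L _ ⟨a, rfl⟩ _ (by simp)).2 ⟨b, rfl⟩)
  have llls : ∀ a b, cutTerm M α (H (ll a)) (H (ls b)) = α (H (ll a)) * (1 - α (H (ls b))) :=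
    fun a b => h1 _ _ ((L _ ⟨b, rfl⟩ _ (by simp)).2 ⟨a, rfl⟩).symm
  have rsrl : ∀ a b, cutTerm M α (H (rs a)) (H (rl b)) = α (H (rs a)) * (1 - α (H (rl b))) :=
    fun a b => h1 _ _ ((R _ ⟨a, rfl⟩ _ (by simp)).2 ⟨b, rfl⟩)
  have rlrs : ∀ a b, cutTerm M α (H (rl a)) (H (rs b)) = α (H (rl a)) * (1 - α (H (rs b))) :=
    fun a b => h1 _ _ ((R _ ⟨b, rfl⟩ _ (by simp)).2 ⟨a, rfl⟩).symm
  have llll : ∀ a b, cutTerm M α (H (ll a)) (H (ll b)) = α (H (ll a)) * (1 - α (H (ll b))) :=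
    fun a b => h1 _ _ (hH.long_meets _ (Or.inl ⟨a, rfl⟩) _ (Or.inl ⟨b, rfl⟩))
  have llrl : ∀ a b, cutTerm M α (H (ll a)) (H (rl b)) = α (H (ll a)) * (1 - α (H (rl b))) :=
    fun a b => h1 _ _ (hH.long_meets _ (Or.inl ⟨a, rfl⟩) _ (Or.inr ⟨b, rfl⟩))
  have rlll : ∀ a b, cutTerm M α (H (rl a)) (H (ll b)) = α (H (rl a)) * (1 - α (H (ll b))) :=
    fun a b => h1 _ _ (hH.long_meets _ (Or.inr ⟨a, rfl⟩) _ (Or.inl ⟨b, rfl⟩))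
  have rlrl : ∀ a b, cutTerm M α (H (rl a)) (H (rl b)) = α (H (rl a)) * (1 - α (H (rl b))) :=
    fun a b => h1 _ _ (hH.long_meets _ (Or.inr ⟨a, rfl⟩) _ (Or.inr ⟨b, rfl⟩))
  simp only [sum_gadgetIdx, lsls, lsrs, lsrl, rsls, rsrs, rsll, rlls, llrs, lsll, llls, rsrl, rlrs,
    llll, llrl, rlll, rlrl, Finset.sum_const_zero, Finset.sum_add_distrib, ← Finset.mul_sum,
    ← Finset.sum_mul, Finset.sum_sub_distrib, Finset.sum_const, Finset.card_univ, Fintype.card_fin,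
    nsmul_eq_mul, mul_one]
  ring

open Classical in
theorem cutTerm_add_cutTerm (u v : ι) : cutTerm M α u v + cutTerm M α v u =
    (if Meets (M u) (M v) then 1 else 0) * differ (α u) (α v) := by
  unfold cutTerm differ
  rw [meets_comm (I := M v)]
  split_ifs <;> ring

/-- How the intervals `J κ` meet a gadget: `cov`, `wl`, `wr` and `st` are the indicator functions of
those that meet everything, that weakly intersect to the left, that weakly intersect to the right,
and that strongly intersect to the left. -/
structure Meeting {K : Type*} (M : ι → NonemptyInterval ℝ) (J : K → ι) (H : GadgetIdx x y → ι)
    (cov wl wr st : K → ℤ) : Prop where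
  ls : open Classical in ∀ κ a, (if Meets (M (J κ)) (M (H (ls a))) then 1 else 0) = cov κ + st κ
  ll : open Classical in ∀ κ a,
    (if Meets (M (J κ)) (M (H (ll a))) then 1 else 0) = cov κ + wl κ + st κ
  rs : open Classical in ∀ κ a, (if Meets (M (J κ)) (M (H (rs a))) then 1 else 0) = cov κ
  rl : open Classical in ∀ κ a, (if Meets (M (J κ)) (M (H (rl a))) then 1 else 0) = cov κ + wr κ

/-- The number of cut edges that have an end in a gadget. -/
noncomputable def gadgetValue {K : Type*} [Fintype K] (M : ι → NonemptyInterval ℝ) (α : ι → ℤ)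
    (J : K → ι) (H : GadgetIdx x y → ι) : ℤ :=
  ∑ a, ∑ b, cutTerm M α (H a) (H b) +
    ∑ κ, ∑ a, (cutTerm M α (J κ) (H a) + cutTerm M α (H a) (J κ))

theorem sum_differ {z : ℕ} (a : ℤ) (f : Fin z → ℤ) :
    ∑ i, differ a (f i) = a * (z - ∑ i, f i) + (1 - a) * ∑ i, f i := by
  simp only [differ, Finset.sum_add_distrib, ← Finset.mul_sum, Finset.sum_sub_distrib,
    Finset.sum_const, Finset.card_univ, Fintype.card_fin, nsmul_eq_mul, mul_one]

theorem Meeting.gadgetValue_eq {K : Type*} [Fintype K] {J : K → ι} {cov wl wr st : K → ℤ}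
    (hα : IsIndicator α) (hH : IsGrainedGadget fun a => M (H a))
    (hJ : Meeting M J H cov wl wr st) {a b c d : ℤ} (ha : ∑ i, α (H (.ls i)) = a)
    (hb : ∑ i, α (H (.ll i)) = b) (hc : ∑ i, α (H (.rs i)) = c) (hd : ∑ i, α (H (.rl i)) = d) :
    gadgetValue M α J H =
      a * (y - b) + b * (x - a) + c * (y - d) + d * (x - c) + (b + d) * (2 * y - b - d) +
      ((∑ κ, cov κ * α (J κ)) * (2 * x + 2 * y - (a + b + c + d)) +
        (∑ κ, cov κ * (1 - α (J κ))) * (a + b + c + d)) +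
      ((∑ κ, wl κ * α (J κ)) * (y - b) + (∑ κ, wl κ * (1 - α (J κ))) * b) +
      ((∑ κ, wr κ * α (J κ)) * (y - d) + (∑ κ, wr κ * (1 - α (J κ))) * d) +
      ((∑ κ, st κ * α (J κ)) * (x + y - a - b) + (∑ κ, st κ * (1 - α (J κ))) * (a + b)) := by
  unfold gadgetValue
  rw [sum_cutTerm_gadget hα hH, ha, hb, hc, hd]
  simp only [cutTerm_add_cutTerm, sum_gadgetIdx, hJ.ls, hJ.ll, hJ.rs, hJ.rl, ← Finset.mul_sum,
    sum_differ, ha, hb, hc, hd]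
  have ext : ∑ κ, ((cov κ + st κ) * (α (J κ) * (x - a) + (1 - α (J κ)) * a) +
        (cov κ + wl κ + st κ) * (α (J κ) * (y - b) + (1 - α (J κ)) * b) +
        cov κ * (α (J κ) * (x - c) + (1 - α (J κ)) * c) +
        (cov κ + wr κ) * (α (J κ) * (y - d) + (1 - α (J κ)) * d)) =
      ((∑ κ, cov κ * α (J κ)) * (2 * x + 2 * y - (a + b + c + d)) +
        (∑ κ, cov κ * (1 - α (J κ))) * (a + b + c + d)) +
      ((∑ κ, wl κ * α (J κ)) * (y - b) + (∑ κ, wl κ * (1 - α (J κ))) * b) +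
      ((∑ κ, wr κ * α (J κ)) * (y - d) + (∑ κ, wr κ * (1 - α (J κ))) * d) +
      ((∑ κ, st κ * α (J κ)) * (x + y - a - b) + (∑ κ, st κ * (1 - α (J κ))) * (a + b)) := by
    simp only [Finset.sum_mul, ← Finset.sum_add_distrib]
    exact Finset.sum_congr rfl fun κ _ => by ring
  rw [ext]
  ring

end

/-- Here a, b, c, d count the intervals of LS, LL, RS, RL in the first part, and cA, cB, … count the
joining intervals of each kind on the two sides. The value is affine in a and in c separately, so
both may be moved to 0 or p. Then p exceeds 2q by at least the number of joining intervals, which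
makes it best to put all long intervals opposite their short ones. If this leaves LL and RL on the
same side, the q² edges between them are lost, and `hq` says that this outweighs what the joining
intervals could gain. -/
theorem gadget_bound {p q a b c d cA cB lA lB rA rB tA tB : ℤ}
    (ha : 0 ≤ a) (ha' : a ≤ p) (hb : 0 ≤ b) (hb' : b ≤ q) (hc : 0 ≤ c) (hc' : c ≤ p)
    (hd : 0 ≤ d) (hd' : d ≤ q)
    (hcA : 0 ≤ cA) (hcB : 0 ≤ cB) (hlA : 0 ≤ lA) (hlB : 0 ≤ lB) (hrA : 0 ≤ rA) (hrB : 0 ≤ rB)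
    (htA : 0 ≤ tA) (htB : 0 ≤ tB)
    (hp : 2 * q + (cA + cB + lA + lB + rA + rB + tA + tB) ≤ p)
    (hq : (p + q) * (cA + cB) + q * (rA + rB) ≤ q ^ 2) :
    let v := a * (q - b) + b * (p - a) + c * (q - d) + d * (p - c) + (b + d) * (2 * q - b - d) +
      (cA * (2 * p + 2 * q - (a + b + c + d)) + cB * (a + b + c + d)) +
      (lA * (q - b) + lB * b) + (rA * (q - d) + rB * d) +
      (tA * (p + q - a - b) + tB * (a + b))
    v ≤ 2 * p * q + q ^ 2 + (p + q) * (cA + cB) + (q * (lA + rB + tA) + p * tB) ∨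
    v ≤ 2 * p * q + q ^ 2 + (p + q) * (cA + cB) + (q * (lB + rA + tB) + p * tA) := by
  intro v
  have lin : ∀ z X Y : ℤ, 0 ≤ z → z ≤ p →
      z * X + (p - z) * Y ≤ p * X ∨ z * X + (p - z) * Y ≤ p * Y := by
    intro z X Y h1 h2
    rcases le_total X Y with h | h
    · right
      linarith [mul_le_mul_of_nonneg_left h h1]
    · left
      linarith [mul_le_mul_of_nonneg_left h (sub_nonneg.2 h2)]
  have hv : v = (a * (q - b + cB + tB) + (p - a) * (b + cA + tA)) +
      (c * (q - d + cB) + (p - c) * (d + cA)) + ((b + d) * (2 * q - b - d) +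
        cA * (2 * q - b - d) + cB * (b + d) + lA * (q - b) + lB * b + rA * (q - d) + rB * d +
        tA * (q - b) + tB * b) := by
    ring
  have hp0 : 0 ≤ p - 2 * q - (cA + cB + lA + lB + rA + rB + tA + tB) := by linarith
  have hb1 : 0 ≤ q - b := by linarith
  have hd1 : 0 ≤ q - d := by linarith
  have hq0 : 0 ≤ q := hb.trans hb'
  have hpq : 0 ≤ p + q := by linarith
  have hpq' : 0 ≤ p - q := by linarith
  have m1 := mul_nonneg hpq' hcA
  have m2 := mul_nonneg hpq' hcB
  have m5 := mul_nonneg hq0 hcA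
  have m6 := mul_nonneg hq0 hcB
  have m3 := mul_nonneg hq0 hrA
  have m4 := mul_nonneg hq0 hrB
  -- The four cases are (a, c) = (p, p), (p, 0), (0, p), (0, 0). The middle two are the aligned
  -- splits; the outer two are compared with the aligned split having the same a.
  rcases lin a (q - b + cB + tB) (b + cA + tA) ha ha' with h1 | h1 <;>
    rcases lin c (q - d + cB) (d + cA) hc hc' with h2 | h2
  · left
    have := mul_nonneg hb hp0
    have := mul_nonneg hd hp0
    linarith [mul_nonneg hb hcA, mul_nonneg hb hlA, mul_nonneg hb htA, mul_nonneg hb hrA,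
      mul_nonneg hb hrB, mul_nonneg hd hcA, mul_nonneg hd hlA, mul_nonneg hd hlB, mul_nonneg hd htA,
      mul_nonneg hd htB, mul_nonneg hd hrA, sq_nonneg (b + d)]
  · left
    have := mul_nonneg hb hp0
    have := mul_nonneg hd1 hp0
    linarith [mul_nonneg hb hcA, mul_nonneg hb hlA, mul_nonneg hb htA, mul_nonneg hb hrA,
      mul_nonneg hb hrB, mul_nonneg hd1 hcB, mul_nonneg hd1 hlA, mul_nonneg hd1 hlB,
      mul_nonneg hd1 htA, mul_nonneg hd1 htB, mul_nonneg hd1 hrB, sq_nonneg (b - (q - d)),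
      mul_nonneg hq0 hb, mul_nonneg hq0 hd1]
  · right
    have := mul_nonneg hb1 hp0
    have := mul_nonneg hd hp0
    linarith [mul_nonneg hb1 hcB, mul_nonneg hb1 hlB, mul_nonneg hb1 htB, mul_nonneg hb1 hrA,
      mul_nonneg hb1 hrB, mul_nonneg hd hcA, mul_nonneg hd hlA, mul_nonneg hd hlB,
      mul_nonneg hd htA, mul_nonneg hd htB, mul_nonneg hd hrA, sq_nonneg (d - (q - b)),
      mul_nonneg hq0 hb1, mul_nonneg hq0 hd]
  · right
    have := mul_nonneg hb1 hp0
    have := mul_nonneg hd1 hp0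
    linarith [mul_nonneg hb1 hcB, mul_nonneg hb1 hlB, mul_nonneg hb1 htB, mul_nonneg hb1 hrA,
      mul_nonneg hb1 hrB, mul_nonneg hd1 hcB, mul_nonneg hd1 hlA, mul_nonneg hd1 hlB,
      mul_nonneg hd1 htA, mul_nonneg hd1 htB, mul_nonneg hd1 hrB, sq_nonneg ((q - b) + (q - d))]

/-! ### Aligned splits of a gadget -/

section

variable {ι : Type*} {M : ι → NonemptyInterval ℝ} {α : ι → ℤ} {x y : ℕ} {H : GadgetIdx x y → ι}
  {K : Type*} [Fintype K] {J : K → ι} {cov wl wr st : K → ℤ}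

/-- The number of cut edges between the intervals `J κ` and a gadget whose left long intervals are
all on the side `s`, as far as it depends on `s`. -/
def payoff (α : ι → ℤ) (J : K → ι) (wl wr st : K → ℤ) (x y s : ℤ) : ℤ :=
  ∑ κ, (y * (wl κ + st κ) * differ (α (J κ)) s +
    (y * wr κ + x * st κ) * (1 - differ (α (J κ)) s))

theorem sum_eq_add_of_sides (α : ι → ℤ) (J : K → ι) (f : K → ℤ) :
    ∑ κ, f κ = ∑ κ, f κ * α (J κ) + ∑ κ, f κ * (1 - α (J κ)) := by
  rw [← Finset.sum_add_distrib]
  exact Finset.sum_congr rfl fun κ _ => by ring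

theorem payoff_zero (z t : ℤ) : payoff α J wl wr st z t 0 =
    t * (∑ κ, wl κ * α (J κ) + ∑ κ, wr κ * (1 - α (J κ)) + ∑ κ, st κ * α (J κ)) +
    z * ∑ κ, st κ * (1 - α (J κ)) := by
  unfold payoff differ
  simp only [Finset.mul_sum, ← Finset.sum_add_distrib]
  exact Finset.sum_congr rfl fun κ _ => by ring

theorem payoff_one (z t : ℤ) : payoff α J wl wr st z t 1 =
    t * (∑ κ, wl κ * (1 - α (J κ)) + ∑ κ, wr κ * α (J κ) + ∑ κ, st κ * (1 - α (J κ))) +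
    z * ∑ κ, st κ * α (J κ) := by
  unfold payoff differ
  simp only [Finset.mul_sum, ← Finset.sum_add_distrib]
  exact Finset.sum_congr rfl fun κ _ => by ring

/-- An aligned gadget has x + y intervals on each side, so a covering interval gains x + y wherever
it lies; only the partial intersections depend on s. -/
theorem Meeting.gadgetValue_aligned (hα : IsIndicator α) (hH : IsGrainedGadget fun a => M (H a))
    (hJ : Meeting M J H cov wl wr st) {s : ℤ} (hs : s = 0 ∨ s = 1)
    (hls : ∀ i, α (H (.ls i)) = 1 - s) (hll : ∀ i, α (H (.ll i)) = s)
    (hrs : ∀ i, α (H (.rs i)) = s) (hrl : ∀ i, α (H (.rl i)) = 1 - s) :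
    gadgetValue M α J H =
      2 * x * y + y ^ 2 + (x + y) * ∑ κ, cov κ + payoff α J wl wr st x y s := by
  rw [hJ.gadgetValue_eq (a := x * (1 - s)) (b := y * s) (c := x * s) (d := y * (1 - s)) hα hH
    (by simp only [hls]; simp [mul_sub]) (by simp [hll]) (by simp [hrs])
    (by simp only [hrl]; simp [mul_sub]), sum_eq_add_of_sides α J cov]
  rcases hs with rfl | rfl
  · rw [payoff_zero]
    ring
  · rw [payoff_one]
    ring

theorem Meeting.exists_gadgetValue_le (hα : IsIndicator α) (hH : IsGrainedGadget fun a => M (H a))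
    (hJ : Meeting M J H cov wl wr st) (hcov : ∀ κ, 0 ≤ cov κ) (hwl : ∀ κ, 0 ≤ wl κ)
    (hwr : ∀ κ, 0 ≤ wr κ) (hst : ∀ κ, 0 ≤ st κ)
    (hx : 2 * (y : ℤ) + ∑ κ, (cov κ + wl κ + wr κ + st κ) ≤ x)
    (hy : ((x : ℤ) + y) * ∑ κ, cov κ + y * ∑ κ, wr κ ≤ y ^ 2) :
    ∃ s : ℤ, (s = 0 ∨ s = 1) ∧ gadgetValue M α J H ≤
      2 * x * y + y ^ 2 + (x + y) * ∑ κ, cov κ + payoff α J wl wr st x y s := by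
  have nA : ∀ f : K → ℤ, (∀ κ, 0 ≤ f κ) → 0 ≤ ∑ κ, f κ * α (J κ) := fun f hf =>
    Finset.sum_nonneg fun κ _ => mul_nonneg (hf κ) (by rcases hα (J κ) with h | h <;> simp [h])
  have nB : ∀ f : K → ℤ, (∀ κ, 0 ≤ f κ) → 0 ≤ ∑ κ, f κ * (1 - α (J κ)) := fun f hf =>
    Finset.sum_nonneg fun κ _ => mul_nonneg (hf κ) (by rcases hα (J κ) with h | h <;> simp [h])
  have cnt0 : ∀ {z : ℕ} (f : Fin z → ι), 0 ≤ ∑ i, α (f i) := fun f =>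
    Finset.sum_nonneg fun i _ => by rcases hα (f i) with h | h <;> simp [h]
  have cnt1 : ∀ {z : ℕ} (f : Fin z → ι), ∑ i, α (f i) ≤ z := fun {z} f => by
    calc ∑ i, α (f i) ≤ ∑ _i : Fin z, (1 : ℤ) :=
          Finset.sum_le_sum fun i _ => by rcases hα (f i) with h | h <;> simp [h]
      _ = z := by simp
  simp only [Finset.sum_add_distrib] at hx
  rw [sum_eq_add_of_sides α J cov, sum_eq_add_of_sides α J wl,
    sum_eq_add_of_sides α J wr, sum_eq_add_of_sides α J st] at hx
  rw [sum_eq_add_of_sides α J cov, sum_eq_add_of_sides α J wr] at hy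
  rcases gadget_bound (cnt0 fun i => H (.ls i)) (cnt1 fun i => H (.ls i))
    (cnt0 fun i => H (.ll i)) (cnt1 fun i => H (.ll i)) (cnt0 fun i => H (.rs i))
    (cnt1 fun i => H (.rs i)) (cnt0 fun i => H (.rl i)) (cnt1 fun i => H (.rl i))
    (nA cov hcov) (nB cov hcov) (nA wl hwl) (nB wl hwl) (nA wr hwr) (nB wr hwr) (nA st hst)
    (nB st hst) (by linarith) hy with h | h
  · refine ⟨0, Or.inl rfl, ?_⟩
    rw [hJ.gadgetValue_eq hα hH rfl rfl rfl rfl, payoff_zero, sum_eq_add_of_sides α J cov]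
    exact h
  · refine ⟨1, Or.inr rfl, ?_⟩
    rw [hJ.gadgetValue_eq hα hH rfl rfl rfl rfl, payoff_one, sum_eq_add_of_sides α J cov]
    exact h

end

section

/-! ### Decomposition of the cuts of a reduction model -/

variable {n m p q p' q' : ℕ}

theorem sum_modelIdx (f : ModelIdx n m p q p' q' → ℤ) :
    ∑ u, f u = ∑ g : Fin n × Fin (m + 1), ∑ a, f (.esc (.gadget g.1 g.2 a)) +
      ∑ j, ∑ a, f (.edge j a) + ∑ κ : JoinIdx n m, f (κ.toModel p q p' q') := by
  let e : ((Fin n × Fin (m + 1)) × GadgetIdx p q) ⊕ (Fin m × GadgetIdx p' q') ⊕ JoinIdx n m ≃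
      ModelIdx n m p q p' q' :=
    { toFun := Sum.elim (fun g => .esc (.gadget g.1.1 g.1.2 g.2))
        (Sum.elim (fun g => .edge g.1 g.2) fun κ => κ.toModel p q p' q')
      invFun := fun u => match u with
        | .esc (.gadget i j a) => .inl ((i, j), a)
        | .esc (.link i j b) => .inr (.inr (.inl (i, j, b)))
        | .edge j a => .inr (.inl (j, a))
        | .conn j c => .inr (.inr (.inr (j, c)))
      left_inv := by rintro (⟨⟨i, j⟩, a⟩ | ⟨j, a⟩ | ⟨i, j, b⟩ | ⟨j, c⟩) <;> rfl
      right_inv := by rintro ((_ | _) | _ | _) <;> rfl }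
  rw [← e.sum_comp]
  simp only [Fintype.sum_sum_type, ← add_assoc, Fintype.sum_prod_type]
  rfl

section

variable {V : Type*} {G : SimpleGraph V} {πV : Fin n ≃ V} {πE : Fin m ≃ G.edgeSet}
  {M : ModelIdx n m p q p' q' → NonemptyInterval ℝ}

theorem cutTerm_eq_zero {ι : Type*} {M : ι → NonemptyInterval ℝ} {u v : ι} (α : ι → ℤ)
    (h : ¬ Meets (M u) (M v)) : cutTerm M α u v = 0 := if_neg h

/-- Different gadgets are disjoint, so an edge lies in one gadget, joins a gadget to a joining
interval, or joins two joining intervals. -/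
theorem IsReductionModel.sum_cutTerm (hM : IsReductionModel G πV πE M) (hn : 0 < n)
    (α : ModelIdx n m p q p' q' → ℤ) :
    ∑ u, ∑ v, cutTerm M α u v =
      ∑ g : Fin n × Fin (m + 1), gadgetValue M α (JoinIdx.toModel p q p' q')
        (fun a => .esc (.gadget g.1 g.2 a)) +
      ∑ j, gadgetValue M α (JoinIdx.toModel p q p' q') (fun a => .edge j a) +
      ∑ κ : JoinIdx n m, ∑ κ' : JoinIdx n m,
        cutTerm M α (κ.toModel p q p' q') (κ'.toModel p q p' q') := by
  have hh : ∀ (g g' : Fin n × Fin (m + 1)) (a a' : GadgetIdx p q), g' ≠ g →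
      cutTerm M α (.esc (.gadget g.1 g.2 a)) (.esc (.gadget g'.1 g'.2 a')) = 0 :=
    fun g g' a a' hg => cutTerm_eq_zero α (hM.escalator.disjoint _ _ _ _ hg.symm a a')
  have he : ∀ (g : Fin n × Fin (m + 1)) (j : Fin m) (a : GadgetIdx p q) (a' : GadgetIdx p' q'),
      cutTerm M α (.esc (.gadget g.1 g.2 a)) (.edge j a') = 0 :=
    fun g j a a' => cutTerm_eq_zero α (hM.not_gadget_meets_edge _ _ _ a a')
  have eh : ∀ (g : Fin n × Fin (m + 1)) (j : Fin m) (a : GadgetIdx p q) (a' : GadgetIdx p' q'),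
      cutTerm M α (.edge j a') (.esc (.gadget g.1 g.2 a)) = 0 :=
    fun g j a a' => cutTerm_eq_zero α fun h => hM.not_gadget_meets_edge _ _ _ a a' h.symm
  have ee : ∀ (j j' : Fin m) (a a' : GadgetIdx p' q'), j' ≠ j →
      cutTerm M α (.edge j a) (.edge j' a') = 0 :=
    fun j j' a a' hj => cutTerm_eq_zero α (hM.not_edge_meets_edge hn hj.symm a a')
  have hh' : ∀ (g : Fin n × Fin (m + 1)) (a : GadgetIdx p q),
      ∑ g' : Fin n × Fin (m + 1), ∑ a',
        cutTerm M α (.esc (.gadget g.1 g.2 a)) (.esc (.gadget g'.1 g'.2 a')) =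
      ∑ a', cutTerm M α (.esc (.gadget g.1 g.2 a)) (.esc (.gadget g.1 g.2 a')) := fun g a =>
    Fintype.sum_eq_single g fun g' hg => Finset.sum_eq_zero fun a' _ => hh g g' a a' hg
  have ee' : ∀ (j : Fin m) (a : GadgetIdx p' q'),
      ∑ j', ∑ a', cutTerm M α (.edge j a) (.edge j' a') =
      ∑ a', cutTerm M α (.edge j a) (.edge j a') := fun j a =>
    Fintype.sum_eq_single j fun j' hj => Finset.sum_eq_zero fun a' _ => ee j j' a a' hj
  simp only [sum_modelIdx, gadgetValue, he, eh, hh', ee', Finset.sum_add_distrib,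
    Finset.sum_const_zero, add_zero, zero_add]
  have c1 : ∑ κ : JoinIdx n m, ∑ g : Fin n × Fin (m + 1), ∑ a,
      cutTerm M α (κ.toModel p q p' q') (.esc (.gadget g.1 g.2 a)) =
      ∑ g : Fin n × Fin (m + 1), ∑ κ : JoinIdx n m, ∑ a,
      cutTerm M α (κ.toModel p q p' q') (.esc (.gadget g.1 g.2 a)) := Finset.sum_comm
  have c2 : ∑ κ : JoinIdx n m, ∑ j, ∑ a, cutTerm M α (κ.toModel p q p' q') (.edge j a) =
      ∑ j, ∑ κ : JoinIdx n m, ∑ a, cutTerm M α (κ.toModel p q p' q') (.edge j a) :=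
    Finset.sum_comm
  have c3 : ∀ g : Fin n × Fin (m + 1), ∑ a, ∑ κ : JoinIdx n m,
      cutTerm M α (.esc (.gadget g.1 g.2 a)) (κ.toModel p q p' q') =
      ∑ κ : JoinIdx n m, ∑ a, cutTerm M α (.esc (.gadget g.1 g.2 a)) (κ.toModel p q p' q') :=
    fun g => Finset.sum_comm
  have c4 : ∀ j : Fin m, ∑ a, ∑ κ : JoinIdx n m,
      cutTerm M α (.edge j a) (κ.toModel p q p' q') =
      ∑ κ : JoinIdx n m, ∑ a, cutTerm M α (.edge j a) (κ.toModel p q p' q') :=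
    fun g => Finset.sum_comm
  rw [c1, c2]
  simp only [c3, c4]
  ring

/-! ### How the joining intervals meet the gadgets -/

section

variable (lo hi : Fin m → Fin n)

/-- The joining intervals that contain the gadget of the vertex `i'` in region `j'`. -/
def covGadget (i' : Fin n) (j' : Fin (m + 1)) : JoinIdx n m → ℤ
  | .inl (i, j, _) => (if j' = j.castSucc ∧ i < i' then 1 else 0) +
      if j' = j.succ ∧ i' < i then 1 else 0
  | .inr (j, c) => if j' = j.castSucc ∧ connEnd lo hi j c < i' then 1 else 0

/-- The joining intervals that weakly intersect the gadget of `i'` in region `j'` to the left. -/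
def leftGadget (i' : Fin n) (j' : Fin (m + 1)) : JoinIdx n m → ℤ
  | .inl (i, j, _) => if j' = j.succ ∧ i' = i then 1 else 0
  | .inr _ => 0

/-- The joining intervals that weakly intersect the gadget of `i'` in region `j'` to the right. -/
def rightGadget (i' : Fin n) (j' : Fin (m + 1)) : JoinIdx n m → ℤ
  | .inl (i, j, _) => if j' = j.castSucc ∧ i' = i then 1 else 0
  | .inr (j, c) => if j' = j.castSucc ∧ i' = connEnd lo hi j c then 1 else 0

/-- The joining intervals that contain the gadget of the edge `j'`. -/
def covEdge (j' : Fin m) : JoinIdx n m → ℤ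
  | .inl (_, j, _) => if j' = j then 1 else 0
  | .inr _ => 0

/-- The joining intervals that weakly intersect the gadget of the edge `j'` to the left. -/
def leftEdge (j' : Fin m) : JoinIdx n m → ℤ
  | .inl _ => 0
  | .inr (j, c) => if j' = j ∧ (c = 0 ∨ c = 1) then 1 else 0

/-- The joining intervals that strongly intersect the gadget of the edge `j'` to the left. -/
def strongEdge (j' : Fin m) : JoinIdx n m → ℤ
  | .inl _ => 0
  | .inr (j, c) => if j' = j ∧ ¬ (c = 0 ∨ c = 1) then 1 else 0

variable {lo hi}

theorem IsReductionModel.meeting_gadget (hM : IsReductionModel G πV πE M)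
    (hl : IsLarge n m p q q') (hE : AreEnds πV πE lo hi) (i' : Fin n) (j' : Fin (m + 1)) :
    Meeting M (JoinIdx.toModel p q p' q') (fun a => .esc (.gadget i' j' a))
      (covGadget lo hi i' j') (leftGadget i' j') (rightGadget lo hi i' j') 0 := by
  constructor
  all_goals
    rintro (⟨i, j, b⟩ | ⟨j, c⟩) a
    · simp only [JoinIdx.toModel, hM.link_meets_gadget hl, covGadget, leftGadget, rightGadget,
        LL, RL, Set.mem_range, reduceCtorEq, exists_false, exists_eq, ll.injEq, rl.injEq,
        Pi.zero_apply]
      simp only [Fin.ext_iff, Fin.lt_def, Fin.val_succ, Fin.val_castSucc, and_true, and_false,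
        or_false]
      split_ifs <;> omega
    · simp only [JoinIdx.toModel, hM.conn_meets_gadget hl hE, covGadget, leftGadget, rightGadget,
        RL, Set.mem_range, reduceCtorEq, exists_false, exists_eq, rl.injEq, Pi.zero_apply]
      simp only [Fin.ext_iff, Fin.lt_def, Fin.val_castSucc, and_true, and_false, or_false] <;>
        split_ifs <;> omega

theorem IsReductionModel.meeting_edge (hM : IsReductionModel G πV πE M)
    (hl : IsLarge n m p q q') (hE : AreEnds πV πE lo hi) (j' : Fin m) :
    Meeting M (JoinIdx.toModel p q p' q') (fun a => .edge j' a)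
      (covEdge j') (leftEdge j') 0 (strongEdge j') := by
  constructor
  all_goals
    rintro (⟨i, j, b⟩ | ⟨j, c⟩) a
    · simp [JoinIdx.toModel, hM.link_meets_edge, covEdge, leftEdge, strongEdge, eq_comm]
    · simp only [JoinIdx.toModel, hM.conn_meets_edge hl hE, covEdge, leftEdge, strongEdge,
        LL, LS, Set.mem_range, reduceCtorEq, exists_false, and_false, or_false, exists_eq,
        and_true, Pi.zero_apply, add_zero, ls.injEq, ll.injEq, eq_comm (a := j), false_or, 
        if_false, zero_add]
      try split_ifs <;> first | rfl | tauto

/-! ### Sums over the joining intervals -/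

theorem sum_joinIdx (f : JoinIdx n m → ℤ) :
    ∑ κ, f κ = ∑ i, ∑ j, ∑ b, f (.inl (i, j, b)) + ∑ j, ∑ c, f (.inr (j, c)) := by
  simp only [Fintype.sum_sum_type, Fintype.sum_prod_type]

theorem sum_ite_and {κ : Type*} [Fintype κ] [DecidableEq κ] (x : κ) (P : κ → Prop)
    [DecidablePred P] (f : κ → ℤ) :
    ∑ j, (if j = x ∧ P j then f j else 0) = if P x then f x else 0 := by
  rw [Fintype.sum_eq_single x fun j hj => if_neg fun h => hj h.1]
  simp

theorem sum_lt_add_sum_gt (i : Fin n) :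
    ∑ i', (if i < i' then (1 : ℤ) else 0) + ∑ i', (if i' < i then (1 : ℤ) else 0) = n - 1 := by
  have h : ∀ i' : Fin n, (if i < i' then (1 : ℤ) else 0) + (if i' < i then (1 : ℤ) else 0) =
      1 - if i' = i then 1 else 0 := by
    intro i'
    rcases lt_trichotomy i i' with h | h | h
    · simp [h, h.ne', h.not_gt]
    · simp [h]
    · simp [h, h.ne, h.not_gt]
  rw [← Finset.sum_add_distrib, Finset.sum_congr rfl fun i' _ => h i']
  simp

theorem sum_gt (i : Fin n) : ∑ i', (if i' < i then (1 : ℤ) else 0) = i := by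
  rw [Finset.sum_boole, Finset.filter_gt_eq_Iio, Fin.card_Iio]

theorem sum_lt (i : Fin n) : ∑ i', (if i < i' then (1 : ℤ) else 0) = n - 1 - i := by
  linarith [sum_lt_add_sum_gt i, sum_gt i]

/-- Each of the 2nm links covers n - 1 - i gadgets in its own region and i in the next, n - 1 in
all. -/
theorem sum_covGadget :
    ∑ g : Fin n × Fin (m + 1), ∑ κ, covGadget lo hi g.1 g.2 κ =
      2 * n * m * (n - 1) + ∑ j, ∑ c, ((n : ℤ) - 1 - connEnd lo hi j c) := by
  rw [Finset.sum_comm, sum_joinIdx]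
  simp only [Fintype.sum_prod_type, covGadget, Finset.sum_add_distrib, sum_ite_and, sum_lt, sum_gt]
  simp only [← Finset.sum_add_distrib, sub_add_cancel, Finset.sum_const, Finset.card_univ,
    Fintype.card_fin, nsmul_eq_mul, Nat.cast_ofNat, ← mul_add]
  ring

theorem sum_covEdge (j' : Fin m) : ∑ κ, covEdge (n := n) j' κ = 2 * n := by
  rw [sum_joinIdx]
  simp [covEdge]
  ring

/-- Regroups the payoffs by joining interval: a link collects at two gadgets, a connection at one.
Each then becomes a small optimization of its own. -/
theorem sum_payoff_gadget {ι : Type*} (α : ι → ℤ) (J : JoinIdx n m → ι) (x y : ℤ)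
    (s : Fin n → Fin (m + 1) → ℤ) :
    ∑ g : Fin n × Fin (m + 1), payoff α J (leftGadget g.1 g.2) (rightGadget lo hi g.1 g.2) 0 x y
      (s g.1 g.2) =
    y * (∑ i, ∑ j : Fin m, ∑ b, ((1 - differ (α (J (.inl (i, j, b)))) (s i j.castSucc)) +
        differ (α (J (.inl (i, j, b)))) (s i j.succ)) +
      ∑ j : Fin m, ∑ c,
        (1 - differ (α (J (.inr (j, c)))) (s (connEnd lo hi j c) j.castSucc))) := by
  unfold payoff
  rw [Finset.sum_comm, sum_joinIdx]
  simp only [Fintype.sum_prod_type, leftGadget, rightGadget, Pi.zero_apply, add_zero, mul_zero,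
    zero_mul, zero_add, mul_ite, ite_mul, mul_one, Finset.sum_add_distrib, sum_ite_and, mul_add,
    Finset.mul_sum, Finset.sum_ite_eq', Finset.mem_univ, if_true]
  ring

theorem sum_payoff_edge {ι : Type*} (α : ι → ℤ) (J : JoinIdx n m → ι) (x y : ℤ) (t : Fin m → ℤ) :
    ∑ j, payoff α J (leftEdge j) 0 (strongEdge j) x y (t j) =
    ∑ j, ∑ c : Fin 4, (y * differ (α (J (.inr (j, c)))) (t j) +
      if c = 0 ∨ c = 1 then 0 else x * (1 - differ (α (J (.inr (j, c)))) (t j))) := by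
  unfold payoff
  rw [Finset.sum_comm, sum_joinIdx]
  simp only [leftEdge, strongEdge, Pi.zero_apply, add_zero, mul_zero,
    zero_mul, zero_add, Finset.sum_const_zero]
  refine Finset.sum_congr rfl fun j _ => Finset.sum_congr rfl fun c _ => ?_
  rw [Fintype.sum_eq_single j fun j' hj => by simp [hj]]
  by_cases h : c = 0 ∨ c = 1 <;> simp [h]

theorem sum_ite_castSucc_le (j' : Fin (m + 1)) :
    ∑ j : Fin m, (if j' = j.castSucc then (1 : ℤ) else 0) ≤ 1 := by
  rw [Finset.sum_boole]
  norm_cast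
  refine Finset.card_le_one.2 fun a ha b hb => ?_
  simp only [Finset.mem_filter, Finset.mem_univ, true_and] at ha hb
  exact Fin.castSucc_injective _ (ha.symm.trans hb)

theorem sum_ite_succ_le (j' : Fin (m + 1)) :
    ∑ j : Fin m, (if j' = j.succ then (1 : ℤ) else 0) ≤ 1 := by
  rw [Finset.sum_boole]
  norm_cast
  refine Finset.card_le_one.2 fun a ha b hb => ?_
  simp only [Finset.mem_filter, Finset.mem_univ, true_and] at ha hb
  exact Fin.succ_injective _ (ha.symm.trans hb)

/-- Only the links of two regions and the four connections of one region can meet a given gadget: 2n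
+ 2n + 4. -/
theorem sum_meeting_gadget_le (i' : Fin n) (j' : Fin (m + 1)) :
    ∑ κ, (covGadget lo hi i' j' κ + leftGadget i' j' κ + rightGadget lo hi i' j' κ) ≤
      4 * n + 4 := by
  have h1 : ∀ (i : Fin n) (j : Fin m) (b : Fin 2), covGadget lo hi i' j' (.inl (i, j, b)) +
      leftGadget i' j' (.inl (i, j, b)) + rightGadget lo hi i' j' (.inl (i, j, b)) ≤
      (if j' = j.castSucc then 1 else 0) + if j' = j.succ then 1 else 0 := by
    intro i j b
    simp only [covGadget, leftGadget, rightGadget, Fin.ext_iff, Fin.lt_def, Fin.val_succ,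
      Fin.val_castSucc]
    split_ifs <;> omega
  have h2 : ∀ (j : Fin m) (c : Fin 4), covGadget lo hi i' j' (.inr (j, c)) +
      leftGadget i' j' (.inr (j, c)) + rightGadget lo hi i' j' (.inr (j, c)) ≤
      if j' = j.castSucc then 1 else 0 := by
    intro j c
    simp only [covGadget, leftGadget, rightGadget, Fin.ext_iff, Fin.lt_def, Fin.val_castSucc]
    split_ifs <;> omega
  rw [sum_joinIdx]
  have b1 := sum_ite_castSucc_le j'
  have b2 := sum_ite_succ_le j'
  have e1 : ∑ i : Fin n, ∑ j : Fin m, ∑ b : Fin 2, (covGadget lo hi i' j' (.inl (i, j, b)) +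
      leftGadget i' j' (.inl (i, j, b)) + rightGadget lo hi i' j' (.inl (i, j, b))) ≤
      ∑ i : Fin n, ∑ j : Fin m, ∑ b : Fin 2,
        ((if j' = j.castSucc then 1 else 0) + if j' = j.succ then 1 else 0) :=
    Finset.sum_le_sum fun i _ => Finset.sum_le_sum fun j _ => Finset.sum_le_sum fun b _ => h1 i j b
  have e2 : ∑ j : Fin m, ∑ c : Fin 4, (covGadget lo hi i' j' (.inr (j, c)) +
      leftGadget i' j' (.inr (j, c)) + rightGadget lo hi i' j' (.inr (j, c))) ≤
      ∑ j : Fin m, ∑ c : Fin 4, if j' = j.castSucc then 1 else 0 :=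
    Finset.sum_le_sum fun j _ => Finset.sum_le_sum fun c _ => h2 j c
  simp only [Finset.sum_const, Finset.card_univ, Fintype.card_fin, nsmul_eq_mul, Nat.cast_ofNat,
    ← Finset.mul_sum, Finset.sum_add_distrib] at e1 e2 ⊢
  have hn : (0 : ℤ) ≤ n := Int.natCast_nonneg n
  have := mul_le_mul_of_nonneg_left b1 hn
  have := mul_le_mul_of_nonneg_left b2 hn
  linarith

theorem sum_meeting_edge (j' : Fin m) :
    ∑ κ, (covEdge (n := n) j' κ + leftEdge j' κ + strongEdge j' κ) = 2 * n + 4 := by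
  have h : ∀ (j : Fin m) (c : Fin 4), leftEdge (n := n) j' (.inr (j, c)) +
      strongEdge (n := n) j' (.inr (j, c)) = if j' = j then 1 else 0 := by
    intro j c
    simp only [leftEdge, strongEdge]
    split_ifs <;> first | rfl | tauto
  simp only [add_assoc]
  rw [Finset.sum_add_distrib, sum_covEdge, sum_joinIdx]
  simp only [h]
  simp [leftEdge, strongEdge]

theorem covGadget_nonneg (i' : Fin n) (j' : Fin (m + 1)) (κ : JoinIdx n m) :
    0 ≤ covGadget lo hi i' j' κ := by
  rcases κ with ⟨i, j, b⟩ | ⟨j, c⟩ <;> simp only [covGadget] <;> positivity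

theorem leftGadget_nonneg (i' : Fin n) (j' : Fin (m + 1)) (κ : JoinIdx n m) :
    0 ≤ leftGadget i' j' κ := by
  rcases κ with ⟨i, j, b⟩ | ⟨j, c⟩ <;> simp only [leftGadget] <;> positivity

theorem rightGadget_nonneg (i' : Fin n) (j' : Fin (m + 1)) (κ : JoinIdx n m) :
    0 ≤ rightGadget lo hi i' j' κ := by
  rcases κ with ⟨i, j, b⟩ | ⟨j, c⟩ <;> simp only [rightGadget] <;> positivity

theorem covEdge_nonneg (j' : Fin m) (κ : JoinIdx n m) : 0 ≤ covEdge j' κ := by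
  rcases κ with ⟨i, j, b⟩ | ⟨j, c⟩ <;> simp only [covEdge] <;> positivity

theorem leftEdge_nonneg (j' : Fin m) (κ : JoinIdx n m) : 0 ≤ leftEdge j' κ := by
  rcases κ with ⟨i, j, b⟩ | ⟨j, c⟩ <;> simp only [leftEdge] <;> positivity

theorem strongEdge_nonneg (j' : Fin m) (κ : JoinIdx n m) : 0 ≤ strongEdge j' κ := by
  rcases κ with ⟨i, j, b⟩ | ⟨j, c⟩ <;> simp only [strongEdge] <;> positivity

end

end

end

section

/-! ### Cuts of the cubic graph -/

variable {n m : ℕ}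

section

variable {V : Type*} {G : SimpleGraph V} {πV : Fin n ≃ V}
  {πE : Fin m ≃ G.edgeSet} {lo hi : Fin m → Fin n}

/-- The numbers of the edges at the vertex number `i`. -/
def edgesAt (lo hi : Fin m → Fin n) (i : Fin n) : Finset (Fin m) :=
  Finset.univ.filter fun j => i = lo j ∨ i = hi j

theorem card_edgesAt [Fintype V] [DecidableRel G.Adj] (hE : AreEnds πV πE lo hi)
    (hG : G.IsRegularOfDegree 3) (i : Fin n) : (edgesAt lo hi i).card = 3 := by
  classical
  rw [← hG (πV i), ← G.card_incidenceFinset_eq_degree]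
  have hmem : ∀ j, j ∈ edgesAt lo hi i ↔ (πE j : Sym2 V) ∈ G.incidenceFinset (πV i) := by
    intro j
    rw [SimpleGraph.mem_incidenceFinset, SimpleGraph.incidenceSet, Set.mem_sep_iff, (hE j).2]
    have := (πE j).2
    rw [(hE j).2] at this
    simp [edgesAt, this]
  refine Finset.card_bij (fun j _ => (πE j : Sym2 V)) (fun j hj => (hmem j).1 hj)
    (fun j _ j' _ h => πE.injective (Subtype.ext h)) fun e he => ?_
  have he' : e ∈ G.edgeSet := ((SimpleGraph.mem_incidenceFinset _ _ _).1 he).1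
  exact ⟨πE.symm ⟨e, he'⟩, (hmem _).2 (by simpa using he), by simp⟩

/-- Double counting of the incident pairs of a vertex and an edge. -/
theorem sum_ends (hE : AreEnds πV πE lo hi) (f : Fin n → Fin m → ℤ) :
    ∑ j, (f (lo j) j + f (hi j) j) = ∑ i, ∑ j ∈ edgesAt lo hi i, f i j := by
  simp only [edgesAt, Finset.sum_filter]
  rw [Finset.sum_comm]
  refine Finset.sum_congr rfl fun j _ => ?_
  have hne : lo j ≠ hi j := (hE j).1.ne
  have h : ∀ i, (if i = lo j ∨ i = hi j then f i j else 0) =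
      (if i = lo j then f i j else 0) + if i = hi j then f i j else 0 := by
    intro i
    by_cases h1 : i = lo j
    · simp [h1, hne]
    · simp [h1]
  simp [h, Finset.sum_add_distrib]

theorem two_mul_card_edges [Fintype V] [DecidableRel G.Adj] (hE : AreEnds πV πE lo hi)
    (hG : G.IsRegularOfDegree 3) :
    2 * (m : ℤ) = 3 * n := by
  have h := sum_ends hE fun _ _ => 1
  simp only [Finset.sum_const, card_edgesAt hE hG] at h
  simp at h
  linarith

/-- Every vertex is an end of three edges, with two connections for each, so the sum is the same for
all orderings. -/
theorem sum_connEnd [Fintype V] [DecidableRel G.Adj] (hE : AreEnds πV πE lo hi)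
    (hG : G.IsRegularOfDegree 3) :
    ∑ j, ∑ c, ((n : ℤ) - 1 - connEnd lo hi j c) = 3 * n * (n - 1) := by
  have h1 : ∀ j, ∑ c, ((n : ℤ) - 1 - connEnd lo hi j c) =
      (2 * ((n : ℤ) - 1 - lo j)) + 2 * ((n : ℤ) - 1 - hi j) := by
    intro j
    simp [Fin.sum_univ_four, connEnd]
    ring
  rw [Finset.sum_congr rfl fun j _ => h1 j, sum_ends hE fun i _ => 2 * ((n : ℤ) - 1 - i)]
  simp only [Finset.sum_const, card_edgesAt hE hG]
  have h2 : ∀ N : ℕ, ∑ i : Fin N, 2 * (i : ℤ) = N * (N - 1) := by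
    intro N
    induction N with
    | zero => simp
    | succ N ih =>
      rw [Fin.sum_univ_castSucc]
      simp only [Fin.val_castSucc, ih, Fin.val_last]
      push_cast
      ring
  have h3 := h2 n
  have h4 : ∑ i : Fin n, 3 • (2 * ((n : ℤ) - 1 - i)) =
      ∑ i : Fin n, 6 * ((n : ℤ) - 1) - 3 * ∑ i : Fin n, 2 * (i : ℤ) := by
    rw [Finset.mul_sum, ← Finset.sum_sub_distrib]
    refine Finset.sum_congr rfl fun i _ => ?_
    simp only [nsmul_eq_mul, Nat.cast_ofNat]
    ring
  rw [h4, h3]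
  simp
  ring

/-- The size of a cut of the graph. -/
theorem ncard_cutSet_eq_sum_differ (hE : AreEnds πV πE lo hi) (A : Set V) {S : Fin n → ℤ}
    (hS : IsIndicator S) (hA : ∀ i, πV i ∈ A ↔ S i = 1) :
    ((cutSet G A).ncard : ℤ) = ∑ j, differ (S (lo j)) (S (hi j)) := by
  classical
  have hcut : cutSet G A = (fun j => (πE j : Sym2 V)) ''
      ((Finset.univ.filter fun j => S (lo j) ≠ S (hi j)) : Set (Fin m)) := by
    have hiff : ∀ j, (πE j : Sym2 V) ∈ cutSet G A ↔ S (lo j) ≠ S (hi j) := by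
      intro j
      have h1 := hA (lo j)
      have h2 := hA (hi j)
      have hadj := (πE j).2
      unfold cutSet
      rw [Set.mem_ofPred_eq, (hE j).2] at *
      simp only [hadj, true_and, Set.mem_compl_iff]
      constructor
      · rintro ⟨u, hu, v, hv, he⟩
        rcases Sym2.eq_iff.1 he with ⟨rfl, rfl⟩ | ⟨rfl, rfl⟩
        · intro h
          exact hv (h2.2 (h ▸ h1.1 hu))
        · intro h
          exact hv (h1.2 (h ▸ h2.1 hu))
      · intro h
        by_cases hl : πV (lo j) ∈ A
        · exact ⟨_, hl, _, fun hh => h ((h1.1 hl).trans (h2.1 hh).symm), rfl⟩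
        · refine ⟨_, h2.2 ?_, _, hl, Sym2.eq_swap⟩
          have := mt h1.2 hl
          rcases hS (lo j) with h3 | h3 <;> rcases hS (hi j) with h4 | h4 <;> simp_all
    ext e
    simp only [Set.mem_image, Finset.coe_filter, Finset.mem_univ, true_and, Set.mem_ofPred_eq]
    constructor
    · intro he
      refine ⟨πE.symm ⟨e, he.1⟩, (hiff _).1 (by simpa using he), by simp⟩
    · rintro ⟨j, hj, rfl⟩
      exact (hiff j).2 hj
  rw [hcut, Set.InjOn.ncard_image fun j _ j' _ h => πE.injective (Subtype.ext h),
    Set.ncard_coe_finset, Finset.card_filter]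
  push_cast
  refine Finset.sum_congr rfl fun j _ => ?_
  rcases hS (lo j) with h3 | h3 <;> rcases hS (hi j) with h4 | h4 <;> simp [h3, h4, differ]

theorem sum_differ_le_maxCut [Finite V] (hE : AreEnds πV πE lo hi) {S : Fin n → ℤ}
    (hS : IsIndicator S) :
    ∑ j, differ (S (lo j)) (S (hi j)) ≤ maxCut G := by
  rw [← ncard_cutSet_eq_sum_differ hE {v | S (πV.symm v) = 1} hS fun i => by simp]
  exact_mod_cast ncard_cutSet_le_maxCut G _

/-! ### Sides that change along the regions -/

theorem differ_triangle {a b c d : ℤ} (ha : a = 0 ∨ a = 1) (hb : b = 0 ∨ b = 1)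
    (hc : c = 0 ∨ c = 1) (hd : d = 0 ∨ d = 1) :
    differ a b ≤ differ c d + differ a c + differ b d := by
  unfold differ
  rcases ha with rfl | rfl <;> rcases hb with rfl | rfl <;> rcases hc with rfl | rfl <;>
    rcases hd with rfl | rfl <;> norm_num

theorem differ_mem {a b : ℤ} (ha : a = 0 ∨ a = 1) (hb : b = 0 ∨ b = 1) :
    differ a b = 0 ∨ differ a b = 1 := by
  unfold differ
  rcases ha with rfl | rfl <;> rcases hb with rfl | rfl <;> norm_num

/-- The parity of a natural number, as an integer. -/
def parity (j : ℕ) : ℤ := (j % 2 : ℕ)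

theorem parity_mem (j : ℕ) : parity j = 0 ∨ parity j = 1 := by
  unfold parity
  omega

theorem parity_succ (j : ℕ) : parity (j + 1) = 1 - parity j := by
  unfold parity
  omega

/-- The side `b` that is taken most often by three sides. -/
theorem exists_majority {ι : Type*} {s : Finset ι} (hs : s.card = 3) {τ : ι → ℤ}
    (hτ : IsIndicator τ) : ∃ b : ℤ, (b = 0 ∨ b = 1) ∧ ∑ j ∈ s, differ (τ j) b ≤ 1 ∧
      ∀ a, (∀ j ∈ s, τ j = a) → ∑ j ∈ s, differ (τ j) b = 0 := by
  have h0 : ∑ j ∈ s, differ (τ j) 0 = ∑ j ∈ s, τ j :=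
    Finset.sum_congr rfl fun j _ => by simp [differ]
  have h1 : ∑ j ∈ s, differ (τ j) 1 = 3 - ∑ j ∈ s, τ j := by
    simp [differ, hs]
  have hn : 0 ≤ ∑ j ∈ s, τ j :=
    Finset.sum_nonneg fun j _ => by rcases hτ j with h | h <;> simp [h]
  have hconst : ∀ a, (∀ j ∈ s, τ j = a) → (∑ j ∈ s, τ j = 0 ∨ ∑ j ∈ s, τ j = 3) := by
    intro a ha
    obtain ⟨j, hj⟩ : s.Nonempty := by
      rw [← Finset.card_pos]
      omega
    rw [Finset.sum_congr rfl ha, Finset.sum_const, hs]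
    rcases hτ j with h | h <;> rw [ha j hj] at h <;> simp [h]
  by_cases h : ∑ j ∈ s, τ j ≤ 1
  · refine ⟨0, Or.inl rfl, by linarith, fun a ha => ?_⟩
    rcases hconst a ha with h' | h' <;> linarith
  · refine ⟨1, Or.inr rfl, by omega, fun a ha => ?_⟩
    rcases hconst a ha with h' | h' <;> omega

/-- Each vertex takes the majority of its bits at its three edges, after removal of the expected
alternation. At most one edge then disagrees with the vertex, and none does if its bits always
alternate. So the disagreements are at most the failures to alternate, and each changes the count by
at most one. -/
theorem sum_differ_le_maxCut_add [Fintype V] [DecidableRel G.Adj]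
    (hE : AreEnds πV πE lo hi) (hG : G.IsRegularOfDegree 3) {s : Fin n → Fin (m + 1) → ℤ} (hs : ∀ i, IsIndicator (s i)) :
    ∑ j : Fin m, differ (s (lo j) j.castSucc) (s (hi j) j.castSucc) ≤
      maxCut G + ∑ i, ∑ j : Fin m, (1 - differ (s i j.castSucc) (s i j.succ)) := by
  -- Adding the parity of the region turns an alternating sequence into a constant one.
  let τ : Fin n → Fin (m + 1) → ℤ := fun i j => differ (s i j) (parity j)
  have hτ : ∀ i, IsIndicator (τ i) := fun i j => differ_mem (hs i j) (parity_mem j)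
  have hτ' : ∀ i, IsIndicator fun j : Fin m => τ i j.castSucc := fun i j => hτ i _
  choose S hS hle hconst using fun i => exists_majority (card_edgesAt hE hG i) (hτ' i)
  have hflip : ∀ i (j : Fin m), 0 ≤ 1 - differ (s i j.castSucc) (s i j.succ) := by
    intro i j
    rcases differ_mem (hs i j.castSucc) (hs i j.succ) with h | h <;> simp [h]
  have hdev : ∀ i, ∑ j ∈ edgesAt lo hi i, differ (τ i j.castSucc) (S i) ≤
      ∑ j : Fin m, (1 - differ (s i j.castSucc) (s i j.succ)) := by
    intro i
    by_cases hz : ∀ j : Fin m, 1 - differ (s i j.castSucc) (s i j.succ) = 0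
    · have hc : ∀ j, τ i j = τ i 0 := by
        intro j
        induction j using Fin.induction with
        | zero => rfl
        | succ j ih =>
          rw [← ih]
          have h := hz j
          simp only [τ, Fin.val_succ, Fin.val_castSucc, parity_succ]
          rcases hs i j.castSucc with h1 | h1 <;> rcases hs i j.succ with h2 | h2 <;>
            rw [h1, h2] at h <;> simp [differ] at h <;> rw [h1, h2] <;> simp [differ]
      rw [hconst i (τ i 0) fun j _ => hc _]
      exact Finset.sum_nonneg fun j _ => hflip i j
    · push Not at hz
      obtain ⟨j, hj⟩ := hz
      have h1 : 1 ≤ 1 - differ (s i j.castSucc) (s i j.succ) := by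
        have := hflip i j
        omega
      exact (hle i).trans (h1.trans (Finset.single_le_sum (fun j _ => hflip i j)
        (Finset.mem_univ j)))
  have heq : ∀ j : Fin m, differ (s (lo j) j.castSucc) (s (hi j) j.castSucc) ≤
      differ (S (lo j)) (S (hi j)) +
        (differ (τ (lo j) j.castSucc) (S (lo j)) + differ (τ (hi j) j.castSucc) (S (hi j))) := by
    intro j
    have h := differ_triangle (hτ (lo j) j.castSucc) (hτ (hi j) j.castSucc) (hS (lo j)) (hS (hi j))
    -- Both ends of an edge are read in the same region, so the parity correction cancels.
    have h2 : differ (τ (lo j) j.castSucc) (τ (hi j) j.castSucc) =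
        differ (s (lo j) j.castSucc) (s (hi j) j.castSucc) := by
      simp only [τ]
      rcases parity_mem (j.castSucc : Fin (m + 1)) with h | h <;> rw [h] <;> unfold differ <;> ring
    linarith
  calc ∑ j : Fin m, differ (s (lo j) j.castSucc) (s (hi j) j.castSucc)
      ≤ ∑ j, (differ (S (lo j)) (S (hi j)) +
        (differ (τ (lo j) j.castSucc) (S (lo j)) + differ (τ (hi j) j.castSucc) (S (hi j)))) :=
        Finset.sum_le_sum fun j _ => heq j
    _ = ∑ j, differ (S (lo j)) (S (hi j)) +
        ∑ i, ∑ j ∈ edgesAt lo hi i, differ (τ i j.castSucc) (S i) := by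
        rw [Finset.sum_add_distrib, sum_ends hE fun i j => differ (τ i j.castSucc) (S i)]
    _ ≤ _ := add_le_add (sum_differ_le_maxCut hE hS) (Finset.sum_le_sum fun i _ => hdev i)

end

end

section

/-! ### Edges between joining intervals -/

variable {n m p q p' q' : ℕ}

section

variable {V : Type*} {G : SimpleGraph V} {πV : Fin n ≃ V} {πE : Fin m ≃ G.edgeSet}
  {M : ModelIdx n m p q p' q' → NonemptyInterval ℝ} {lo hi : Fin m → Fin n}

theorem IsIndicator.differ_mem {ι : Type*} {α : ι → ℤ} (hα : IsIndicator α) (u v : ι) :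
    differ (α u) (α v) = 0 ∨ differ (α u) (α v) = 1 :=
  IntervalMaxCut.differ_mem (hα u) (hα v)

theorem cutTerm_nonneg {ι : Type*} (M : ι → NonemptyInterval ℝ) {α : ι → ℤ} (hα : IsIndicator α)
    (u v : ι) : 0 ≤ cutTerm M α u v := by
  unfold cutTerm
  split_ifs
  · rcases hα u with h | h <;> rcases hα v with h' | h' <;> simp [h, h']
  · rfl

theorem sum_region (f : Fin m → ℤ) :
    ∑ κ : JoinIdx n m, f κ.region = (2 * n + 4) * ∑ j, f j := by
  rw [sum_joinIdx]
  simp only [JoinIdx.region, Finset.sum_const, Finset.card_univ, Fintype.card_fin, nsmul_eq_mul,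
    ← Finset.mul_sum]
  push_cast
  ring

theorem card_near_le (r : Fin m) : ∑ r' : Fin m,
    (if (r : ℕ) ≤ r' + 1 ∧ (r' : ℕ) ≤ r + 1 then (1 : ℤ) else 0) ≤ 3 := by
  rw [Finset.sum_boole]
  have h : (Finset.univ.filter fun r' : Fin m => (r : ℕ) ≤ r' + 1 ∧ (r' : ℕ) ≤ r + 1).card ≤
      (Finset.Icc ((r : ℕ) - 1) (r + 1)).card := by
    refine Finset.card_le_card_of_injOn (fun r' => (r' : ℕ)) ?_ Fin.val_injective.injOn
    intro r' hr'
    simp only [Finset.coe_filter, Finset.mem_univ, true_and, Set.mem_ofPred_eq] at hr'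
    simp only [Finset.coe_Icc, Set.mem_Icc]
    omega
  rw [Nat.card_Icc] at h
  have : (Finset.univ.filter fun r' : Fin m => (r : ℕ) ≤ r' + 1 ∧ (r' : ℕ) ≤ r + 1).card ≤ 3 := by
    omega
  exact_mod_cast this

/-- There are (2n+4)m joining intervals, and each can meet only those of three regions. Each pair is
counted twice, which gives 3m(2n+4)²/2. -/
theorem IsReductionModel.sum_join_le (hM : IsReductionModel G πV πE M)
    (hl : IsLarge n m p q q') (hE : AreEnds πV πE lo hi) {α : ModelIdx n m p q p' q' → ℤ}
    (hα : IsIndicator α) :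
    ∑ κ : JoinIdx n m, ∑ κ' : JoinIdx n m,
      cutTerm M α (κ.toModel p q p' q') (κ'.toModel p q p' q') ≤ 6 * m * (n + 2) ^ 2 := by
  set R := ∑ κ : JoinIdx n m, ∑ κ' : JoinIdx n m,
      cutTerm M α (κ.toModel p q p' q') (κ'.toModel p q p' q') with hR
  let near : Fin m → Fin m → ℤ := fun r r' => if (r : ℕ) ≤ r' + 1 ∧ (r' : ℕ) ≤ r + 1 then 1 else 0
  have h2 : R + R = ∑ κ : JoinIdx n m, ∑ κ' : JoinIdx n m,
      (cutTerm M α (κ.toModel p q p' q') (κ'.toModel p q p' q') +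
        cutTerm M α (κ'.toModel p q p' q') (κ.toModel p q p' q')) := by
    simp only [Finset.sum_add_distrib]
    rw [← hR]
    congr 1
    exact Finset.sum_comm
  have hle : ∀ κ κ' : JoinIdx n m, cutTerm M α (κ.toModel p q p' q') (κ'.toModel p q p' q') +
      cutTerm M α (κ'.toModel p q p' q') (κ.toModel p q p' q') ≤ near κ.region κ'.region := by
    intro κ κ'
    rw [cutTerm_add_cutTerm]
    have hd := hα.differ_mem (κ.toModel p q p' q') (κ'.toModel p q p' q')
    simp only [near]
    split_ifs with h1 h3
    · rcases hd with hd | hd <;> simp [hd]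
    · exfalso
      rw [not_and_or, not_le, not_le] at h3
      rcases h3 with h3 | h3
      · exact hM.not_join_meets_join hl hE h3 h1.symm
      · exact hM.not_join_meets_join hl hE h3 h1
    · simp
    · simp
  have h3 : R + R ≤ ∑ κ : JoinIdx n m, ((2 * n + 4) * 3 : ℤ) := by
    rw [h2]
    refine Finset.sum_le_sum fun κ _ => (Finset.sum_le_sum fun κ' _ => hle κ κ').trans ?_
    rw [sum_region]
    exact mul_le_mul_of_nonneg_left (card_near_le κ.region) (by positivity)
  rw [sum_region (fun _ : Fin m => ((2 * n + 4) * 3 : ℤ))] at h3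
  simp only [Finset.sum_const, Finset.card_univ, Fintype.card_fin, nsmul_eq_mul] at h3
  nlinarith [h3]

/-- The first two connections of an edge meet the last two, which makes four cut edges when their
sides differ. This is the origin of 4k in the threshold. -/
theorem IsReductionModel.le_sum_join (hM : IsReductionModel G πV πE M)
    (hl : IsLarge n m p q q') (hE : AreEnds πV πE lo hi) {α : ModelIdx n m p q p' q' → ℤ}
    (hα : IsIndicator α) {u w : Fin m → ℤ}
    (hu : ∀ j c, c = 0 ∨ c = 1 → α (.conn j c) = u j)
    (hw : ∀ j c, ¬ (c = 0 ∨ c = 1) → α (.conn j c) = w j) :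
    4 * ∑ j, differ (u j) (w j) ≤ ∑ κ : JoinIdx n m, ∑ κ' : JoinIdx n m,
      cutTerm M α (κ.toModel p q p' q') (κ'.toModel p q p' q') := by
  have h0 := cutTerm_nonneg M hα
  have hpair : ∀ j c c', c = 0 ∨ c = 1 → ¬ (c' = 0 ∨ c' = 1) →
      cutTerm M α (.conn j c) (.conn j c') + cutTerm M α (.conn j c') (.conn j c) =
        differ (u j) (w j) := by
    intro j c c' hc hc'
    rw [cutTerm_add_cutTerm, if_pos (hM.conn_meets_conn hl hE j hc hc'), hu j c hc, hw j c' hc',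
      one_mul]
  have h1 : ∀ j, 4 * differ (u j) (w j) ≤
      ∑ c, ∑ c', cutTerm M α (.conn j c) (.conn j c') := by
    intro j
    simp only [Fin.sum_univ_four]
    linarith [hpair j 0 2 (by decide) (by decide), hpair j 0 3 (by decide) (by decide),
      hpair j 1 2 (by decide) (by decide), hpair j 1 3 (by decide) (by decide),
      h0 (.conn j 0) (.conn j 0), h0 (.conn j 0) (.conn j 1), h0 (.conn j 1) (.conn j 0),
      h0 (.conn j 1) (.conn j 1), h0 (.conn j 2) (.conn j 2), h0 (.conn j 2) (.conn j 3),
      h0 (.conn j 3) (.conn j 2), h0 (.conn j 3) (.conn j 3)]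
  have h2 : ∀ j c, ∑ c', cutTerm M α (.conn j c) (.conn j c') ≤
      ∑ κ' : JoinIdx n m, cutTerm M α (.conn j c) (κ'.toModel p q p' q') := by
    intro j c
    rw [sum_joinIdx]
    refine le_add_of_nonneg_of_le (Finset.sum_nonneg fun _ _ => Finset.sum_nonneg fun _ _ =>
      Finset.sum_nonneg fun _ _ => h0 _ _) ?_
    exact Finset.single_le_sum (f := fun j' => ∑ c', cutTerm M α (.conn j c) (.conn j' c'))
      (fun _ _ => Finset.sum_nonneg fun _ _ => h0 _ _) (Finset.mem_univ j)
  rw [sum_joinIdx (fun κ : JoinIdx n m => ∑ κ' : JoinIdx n m, _), Finset.mul_sum]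
  refine le_add_of_nonneg_of_le (Finset.sum_nonneg fun _ _ => Finset.sum_nonneg fun _ _ =>
    Finset.sum_nonneg fun _ _ => Finset.sum_nonneg fun _ _ => h0 _ _) ?_
  exact Finset.sum_le_sum fun j _ => (h1 j).trans (Finset.sum_le_sum fun c _ => h2 j c)

/-! ### Cuts of the model -/

/-- The part of the size of an optimal cut that does not depend on the cut of the graph. -/
def baseValue (n m p q p' q' : ℤ) : ℤ :=
  -- The summands come from the insides of the vertex gadgets and of the edge gadgets; from long
  -- intervals at partial meetings (2q for a link, q for a connection); from covered vertex gadgets;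
  -- from links covering edge gadgets; and from the short intervals met by `conn j 2` and `conn j
  -- 3`.
  n * (m + 1) * (2 * p * q + q ^ 2) + m * (2 * p' * q' + q' ^ 2) + 4 * m * q * (n + 1) +
    (2 * n * m + 3 * n) * (n - 1) * (p + q) + 2 * n * m * (p' + q') + 2 * m * p'

/-- A link wants to agree with the bit of its first gadget and to differ from that of the second; it
can do both only if the bits differ. -/
theorem link_payoff_le {a s s' : ℤ} (ha : a = 0 ∨ a = 1) (hs : s = 0 ∨ s = 1)
    (hs' : s' = 0 ∨ s' = 1) : 1 - differ a s + differ a s' ≤ 2 - (1 - differ s s') := by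
  unfold differ
  rcases ha with rfl | rfl <;> rcases hs with rfl | rfl <;> rcases hs' with rfl | rfl <;> norm_num

/-- Leaving the side of the vertex gadget costs q and gains at most q' ≤ q at the edge gadget. -/
theorem weak_conn_payoff_le {q q' a u t : ℤ} (hq' : 0 ≤ q') (hq : q' ≤ q) (ha : a = 0 ∨ a = 1)
    (hu : u = 0 ∨ u = 1) (ht : t = 0 ∨ t = 1) :
    q * (1 - differ a u) + q' * differ a t ≤ q + q' * differ u t := by
  unfold differ
  rcases ha with rfl | rfl <;> rcases hu with rfl | rfl <;> rcases ht with rfl | rfl <;>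
    norm_num <;> linarith

/-- If t differs from w, a connection staying with w gains q' but loses p' ≥ 2q' at E_j, and one
moving to t loses q ≥ q'. Either way at least q' is lost. -/
theorem strong_conn_payoff_le {q p' q' a w t : ℤ} (hq' : 0 ≤ q') (hq : q' ≤ q) (hp' : 2 * q' ≤ p')
    (ha : a = 0 ∨ a = 1) (hw : w = 0 ∨ w = 1) (ht : t = 0 ∨ t = 1) :
    q * (1 - differ a w) + (q' * differ a t + p' * (1 - differ a t)) ≤
      q + p' - q' * differ w t := by
  unfold differ
  rcases ha with rfl | rfl <;> rcases hw with rfl | rfl <;> rcases ht with rfl | rfl <;>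
    norm_num <;> linarith

/-- The two weak connections reward t ≠ u and the two strong ones penalize t ≠ w at the same rate
2q'. The triangle inequality eliminates t. -/
theorem conn_payoff_le {q p' q' u w t : ℤ} {a : Fin 4 → ℤ} (hq' : 0 ≤ q') (hq : q' ≤ q)
    (hp' : 2 * q' ≤ p') (ha : IsIndicator a) (hu : u = 0 ∨ u = 1) (hw : w = 0 ∨ w = 1)
    (ht : t = 0 ∨ t = 1) :
    q * ∑ c, (1 - differ (a c) (if c = 0 ∨ c = 1 then u else w)) +
      ∑ c, (q' * differ (a c) t + if c = 0 ∨ c = 1 then 0 else p' * (1 - differ (a c) t)) ≤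
      4 * q + 2 * p' + 2 * q' * differ u w := by
  have h0 := weak_conn_payoff_le hq' hq (ha 0) hu ht
  have h1 := weak_conn_payoff_le hq' hq (ha 1) hu ht
  have h2 := strong_conn_payoff_le hq' hq hp' (ha 2) hw ht
  have h3 := strong_conn_payoff_le hq' hq hp' (ha 3) hw ht
  have h4 : differ u t ≤ differ u w + differ w t := by
    unfold differ
    rcases hu with rfl | rfl <;> rcases hw with rfl | rfl <;> rcases ht with rfl | rfl <;> norm_num
  have h5 := mul_le_mul_of_nonneg_left h4 hq'
  simp [Fin.sum_univ_four]
  linarith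

/-- The sizes of the gadgets that make it optimal to split them evenly. -/
structure IsSufficient (n p q p' q' : ℕ) : Prop where
  two_le : 2 ≤ n
  le_q : q' ≤ q
  le_p : 2 * q + 7 * n ≤ p
  le_p' : 2 * q' + 5 * n ≤ p'
  sq_q : (p + q) * (7 * n) ≤ q ^ 2
  sq_q' : (p' + q') * (5 * n) ≤ q' ^ 2

/-- At most 4n + 4 joining intervals meet a vertex gadget, and 4n + 4 ≤ 7n for n ≥ 2; this is the 7n
in p. -/
theorem IsReductionModel.gadgetValue_le (hM : IsReductionModel G πV πE M)
    (hl : IsLarge n m p q q') (hsz : IsSufficient n p q p' q') (hE : AreEnds πV πE lo hi)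
    {α : ModelIdx n m p q p' q' → ℤ} (hα : IsIndicator α) (i : Fin n) (j : Fin (m + 1)) :
    ∃ s : ℤ, (s = 0 ∨ s = 1) ∧
      gadgetValue M α (JoinIdx.toModel p q p' q') (fun a => .esc (.gadget i j a)) ≤
      2 * p * q + q ^ 2 + (p + q) * ∑ κ, covGadget lo hi i j κ +
        payoff α (JoinIdx.toModel p q p' q') (leftGadget i j) (rightGadget lo hi i j) 0 p q s := by
  have hsum := sum_meeting_gadget_le (lo := lo) (hi := hi) i j
  have h2 := hsz.two_le
  have hle : ∑ κ, (covGadget lo hi i j κ + leftGadget i j κ + rightGadget lo hi i j κ) ≤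
      7 * (n : ℤ) := by
    have : (2 : ℤ) ≤ n := by exact_mod_cast h2
    linarith
  have hlp : 2 * (q : ℤ) + 7 * n ≤ p := by exact_mod_cast hsz.le_p
  have hsq : ((p : ℤ) + q) * (7 * n) ≤ q ^ 2 := by exact_mod_cast hsz.sq_q
  refine (hM.meeting_gadget hl hE i j).exists_gadgetValue_le hα (hM.escalator.grained i j)
    (covGadget_nonneg i j) (leftGadget_nonneg i j) (rightGadget_nonneg i j) (fun _ => le_rfl) ?_ ?_
  · simp only [Pi.zero_apply, add_zero]
    linarith
  · rw [Finset.sum_add_distrib, Finset.sum_add_distrib] at hle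
    have a1 := Finset.sum_nonneg fun κ (_ : κ ∈ Finset.univ) => leftGadget_nonneg (m := m) i j κ
    have a2 := Finset.sum_nonneg fun κ (_ : κ ∈ Finset.univ) =>
      rightGadget_nonneg (lo := lo) (hi := hi) i j κ
    have hp0 : (0 : ℤ) ≤ p := Int.natCast_nonneg p
    have hq0 : (0 : ℤ) ≤ q := Int.natCast_nonneg q
    have m1 := mul_le_mul_of_nonneg_left hle (add_nonneg hp0 hq0)
    have m2 := mul_nonneg (add_nonneg hp0 hq0) a1
    have m3 := mul_nonneg hp0 a2
    linarith

/-- Exactly 2n + 4 ≤ 5n joining intervals meet an edge gadget; this is the 5n in p'. -/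
theorem IsReductionModel.edgeValue_le (hM : IsReductionModel G πV πE M)
    (hl : IsLarge n m p q q') (hsz : IsSufficient n p q p' q') (hE : AreEnds πV πE lo hi)
    {α : ModelIdx n m p q p' q' → ℤ} (hα : IsIndicator α) (j : Fin m) :
    ∃ s : ℤ, (s = 0 ∨ s = 1) ∧
      gadgetValue M α (JoinIdx.toModel p q p' q') (fun a => .edge j a) ≤
      2 * p' * q' + q' ^ 2 + (p' + q') * ∑ κ, covEdge (n := n) j κ +
        payoff α (JoinIdx.toModel p q p' q') (leftEdge j) 0 (strongEdge j) p' q' s := by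
  have hsum := sum_meeting_edge (n := n) j
  have h2 : (2 : ℤ) ≤ n := by exact_mod_cast hsz.two_le
  have hlp : 2 * (q' : ℤ) + 5 * n ≤ p' := by exact_mod_cast hsz.le_p'
  have hsq : ((p' : ℤ) + q') * (5 * n) ≤ q' ^ 2 := by exact_mod_cast hsz.sq_q'
  refine (hM.meeting_edge hl hE j).exists_gadgetValue_le hα (hM.grained j)
    (covEdge_nonneg j) (leftEdge_nonneg j) (fun _ => le_rfl) (strongEdge_nonneg j) ?_ ?_
  · simp only [Pi.zero_apply, add_zero]
    linarith
  · rw [sum_covEdge]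
    simp only [Pi.zero_apply, Finset.sum_const_zero, mul_zero, add_zero]
    have hp0 : (0 : ℤ) ≤ p' := Int.natCast_nonneg p'
    have hq0 : (0 : ℤ) ≤ q' := Int.natCast_nonneg q'
    have m1 := mul_nonneg (add_nonneg hp0 hq0) (by positivity : (0 : ℤ) ≤ 3 * n)
    linarith

theorem IsReductionModel.cut_le [Fintype V] [DecidableRel G.Adj]
    (hM : IsReductionModel G πV πE M) (hl : IsLarge n m p q q') (hsz : IsSufficient n p q p' q')
    (hE : AreEnds πV πE lo hi) (hG : G.IsRegularOfDegree 3)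
    {α : ModelIdx n m p q p' q' → ℤ} (hα : IsIndicator α) :
    ∑ u, ∑ v, cutTerm M α u v ≤
      baseValue n m p q p' q' + 2 * q' * maxCut G + 6 * m * (n + 2) ^ 2 := by
  choose s hs hsle using hM.gadgetValue_le hl hsz hE hα
  choose t ht htle using hM.edgeValue_le hl hsz hE hα
  have hq' : (0 : ℤ) ≤ q' := Int.natCast_nonneg q'
  have hqq : (q' : ℤ) ≤ q := by exact_mod_cast hsz.le_q
  have hp' : 2 * (q' : ℤ) ≤ p' := by have := hsz.le_p'; omega
  rw [hM.sum_cutTerm (by have := hsz.two_le; omega)]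
  have hR := hM.sum_join_le hl hE hα
  have hH := Finset.sum_le_sum fun (g : Fin n × Fin (m + 1)) (_ : g ∈ Finset.univ) =>
    hsle g.1 g.2
  have hEd := Finset.sum_le_sum fun (j : Fin m) (_ : j ∈ Finset.univ) => htle j
  simp only [Finset.sum_add_distrib, ← Finset.mul_sum] at hH hEd
  rw [sum_covGadget, sum_connEnd hE hG, sum_payoff_gadget] at hH
  simp only [sum_covEdge] at hEd
  rw [sum_payoff_edge] at hEd
  simp only [Finset.sum_const, Finset.card_univ, Fintype.card_fin, Fintype.card_prod,
    nsmul_eq_mul] at hH hEd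
  push_cast at hH hEd
  -- F is the number of failures to alternate.
  set F := ∑ i, ∑ j : Fin m, (1 - differ (s i j.castSucc) (s i j.succ)) with hF
  have hlink : ∑ i, ∑ j : Fin m, ∑ b : Fin 2,
      ((1 - differ (α (JoinIdx.toModel p q p' q' (.inl (i, j, b)))) (s i j.castSucc)) +
        differ (α (JoinIdx.toModel p q p' q' (.inl (i, j, b)))) (s i j.succ)) ≤
      4 * n * m - 2 * F := by
    calc _ ≤ ∑ i : Fin n, ∑ j : Fin m, ∑ _b : Fin 2,
          (2 - (1 - differ (s i j.castSucc) (s i j.succ))) :=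
          Finset.sum_le_sum fun i _ => Finset.sum_le_sum fun j _ => Finset.sum_le_sum fun b _ =>
            link_payoff_le (hα _) (hs i _) (hs i _)
      _ = 4 * n * m - 2 * F := by
          simp only [hF, Finset.sum_const, Finset.card_univ, Fintype.card_fin, nsmul_eq_mul,
            ← Finset.mul_sum, Finset.sum_sub_distrib]
          push_cast
          ring
  have hcut := sum_differ_le_maxCut_add hE hG (s := s) hs
  rw [← hF] at hcut
  have hend : ∀ (j : Fin m) (c : Fin 4), s (connEnd lo hi j c) j.castSucc =
      if c = 0 ∨ c = 1 then s (lo j) j.castSucc else s (hi j) j.castSucc := by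
    intro j c
    unfold connEnd
    split_ifs <;> rfl
  have hconn : (q : ℤ) * ∑ j : Fin m, ∑ c, (1 - differ (α (JoinIdx.toModel p q p' q' (.inr (j, c))))
        (s (connEnd lo hi j c) j.castSucc)) +
      ∑ j, ∑ c : Fin 4, (q' * differ (α (JoinIdx.toModel p q p' q' (.inr (j, c)))) (t j) +
        if c = 0 ∨ c = 1 then 0
        else p' * (1 - differ (α (JoinIdx.toModel p q p' q' (.inr (j, c)))) (t j))) ≤
      m * (4 * q + 2 * p') +
        2 * q' * ∑ j : Fin m, differ (s (lo j) j.castSucc) (s (hi j) j.castSucc) := by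
    simp only [hend]
    rw [Finset.mul_sum, ← Finset.sum_add_distrib]
    refine (Finset.sum_le_sum fun j _ => conn_payoff_le hq' hqq hp'
      (fun c => hα (JoinIdx.toModel p q p' q' (.inr (j, c)))) (hs (lo j) j.castSucc)
      (hs (hi j) j.castSucc) (ht j)).trans (le_of_eq ?_)
    rw [Finset.sum_add_distrib, ← Finset.mul_sum]
    simp
  have hF0 : 0 ≤ F := Finset.sum_nonneg fun i _ => Finset.sum_nonneg fun j _ => by
    rcases differ_mem (hs i j.castSucc) (hs i j.succ) with h | h <;> simp [h]
  have m1 := mul_le_mul_of_nonneg_left hlink (hq'.trans hqq)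
  have m2 := mul_le_mul_of_nonneg_left hcut hq'
  -- The links lose 2qF, which absorbs the gain of 2q'F allowed by `hcut`.
  have m3 := mul_le_mul_of_nonneg_right hqq hF0
  unfold baseValue
  linarith

/-! ### The cut of the model for a cut of the graph -/

/-- The side of the left long intervals of the gadget of the vertex `i` in region `j`. -/
def vertexSide (S : Fin n → ℤ) (i : Fin n) (j : ℕ) : ℤ := differ (S i) (parity j)

/-- The side of the intervals of a gadget whose left long intervals are on the side `s`. -/
def alignedSide {x y : ℕ} (s : ℤ) : GadgetIdx x y → ℤ
  | ls _ => 1 - s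
  | ll _ => s
  | rs _ => s
  | rl _ => 1 - s

/-- The cut of the model that comes from the cut of the graph with the indicator function `S`. -/
def modelSide (lo hi : Fin m → Fin n) (S : Fin n → ℤ) : ModelIdx n m p q p' q' → ℤ
  | .esc (.gadget i j a) => alignedSide (vertexSide S i j) a
  | .esc (.link i j _) => vertexSide S i j
  | .edge j a => alignedSide (vertexSide S (hi j) j) a
  | .conn j c => vertexSide S (connEnd lo hi j c) j

theorem vertexSide_mem {S : Fin n → ℤ} (hS : IsIndicator S) (i : Fin n) (j : ℕ) :
    vertexSide S i j = 0 ∨ vertexSide S i j = 1 := differ_mem (hS i) (parity_mem j)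

theorem differ_self {a : ℤ} (ha : a = 0 ∨ a = 1) : differ a a = 0 := by
  rcases ha with rfl | rfl <;> rfl

theorem differ_vertexSide_succ {S : Fin n → ℤ} (hS : IsIndicator S) (i : Fin n) (j : ℕ) :
    differ (vertexSide S i j) (vertexSide S i (j + 1)) = 1 := by
  unfold vertexSide
  rw [parity_succ]
  rcases hS i with h | h <;> rcases parity_mem j with h' | h' <;> rw [h, h'] <;> rfl

theorem differ_vertexSide (S : Fin n → ℤ) (i i' : Fin n) (j : ℕ) :
    differ (vertexSide S i j) (vertexSide S i' j) = differ (S i) (S i') := by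
  unfold vertexSide
  rcases parity_mem j with h | h <;> rw [h] <;> unfold differ <;> ring

theorem alignedSide_mem {x y : ℕ} {s : ℤ} (hs : s = 0 ∨ s = 1) (a : GadgetIdx x y) :
    alignedSide s a = 0 ∨ alignedSide s a = 1 := by
  rcases a with a | a | a | a <;> simp only [alignedSide] <;> omega

theorem isIndicator_modelSide {S : Fin n → ℤ} (hS : IsIndicator S) :
    IsIndicator (modelSide (p := p) (q := q) (p' := p') (q' := q') lo hi S) := by
  rintro ((⟨i, j, a⟩ | ⟨i, j, b⟩) | ⟨j, a⟩ | ⟨j, c⟩)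
  · exact alignedSide_mem (vertexSide_mem hS _ _) a
  · exact vertexSide_mem hS _ _
  · exact alignedSide_mem (vertexSide_mem hS _ _) a
  · exact vertexSide_mem hS _ _

/-- `modelSide` makes the estimates for links and connections tight: bits alternate, links and
connections follow the gadget at which they start, and E_j takes the bit of the larger end. -/
theorem IsReductionModel.le_cut [Fintype V] [DecidableRel G.Adj]
    (hM : IsReductionModel G πV πE M) (hl : IsLarge n m p q q')
    (hE : AreEnds πV πE lo hi) (hG : G.IsRegularOfDegree 3) {S : Fin n → ℤ} (hS : IsIndicator S) :
    baseValue n m p q p' q' + (2 * q' + 4) * ∑ j, differ (S (lo j)) (S (hi j)) ≤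
      ∑ u, ∑ v, cutTerm M (modelSide lo hi S) u v := by
  have hα := isIndicator_modelSide (lo := lo) (hi := hi) (p := p) (q := q) (p' := p') (q' := q') hS
  rw [hM.sum_cutTerm (by have := hl.two_le; omega)]
  have hjoin := hM.le_sum_join hl hE hα (u := fun j => vertexSide S (lo j) j)
    (w := fun j => vertexSide S (hi j) j) (fun j c hc => by simp [modelSide, connEnd, hc])
    (fun j c hc => by simp [modelSide, connEnd, hc])
  simp only [differ_vertexSide] at hjoin
  have hH : ∀ g : Fin n × Fin (m + 1), gadgetValue M (modelSide lo hi S)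
      (JoinIdx.toModel p q p' q') (fun a => .esc (.gadget g.1 g.2 a)) = _ := fun g =>
    (hM.meeting_gadget hl hE g.1 g.2).gadgetValue_aligned hα (hM.escalator.grained g.1 g.2)
      (vertexSide_mem hS g.1 g.2) (fun _ => rfl) (fun _ => rfl) (fun _ => rfl) fun _ => rfl
  have hEd : ∀ j : Fin m, gadgetValue M (modelSide lo hi S)
      (JoinIdx.toModel p q p' q') (fun a => .edge j a) = _ := fun j =>
    (hM.meeting_edge hl hE j).gadgetValue_aligned hα (hM.grained j)
      (vertexSide_mem hS (hi j) j) (fun _ => rfl) (fun _ => rfl) (fun _ => rfl) fun _ => rfl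
  simp only [hH, hEd, Finset.sum_add_distrib, ← Finset.mul_sum]
  rw [sum_covGadget, sum_connEnd hE hG,
    sum_payoff_gadget _ _ _ _ (fun i (j : Fin (m + 1)) => vertexSide S i j), sum_payoff_edge]
  have hlink : ∀ (i : Fin n) (j : Fin m) (b : Fin 2),
      (1 - differ (modelSide (p := p) (q := q) (p' := p') (q' := q') lo hi S
          (JoinIdx.toModel p q p' q' (.inl (i, j, b)))) (vertexSide S i (j.castSucc : Fin (m + 1)))) +
        differ (modelSide (p := p) (q := q) (p' := p') (q' := q') lo hi S
          (JoinIdx.toModel p q p' q' (.inl (i, j, b)))) (vertexSide S i (j.succ : Fin (m + 1))) =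
        2 := by
    intro i j b
    simp only [JoinIdx.toModel, modelSide, Fin.val_castSucc, Fin.val_succ,
      differ_self (vertexSide_mem hS _ _), differ_vertexSide_succ hS]
    norm_num
  have hconn : ∀ (j : Fin m) (c : Fin 4),
      1 - differ (modelSide (p := p) (q := q) (p' := p') (q' := q') lo hi S
          (JoinIdx.toModel p q p' q' (.inr (j, c))))
          (vertexSide S (connEnd lo hi j c) (j.castSucc : Fin (m + 1))) = 1 := by
    intro j c
    simp only [JoinIdx.toModel, modelSide, Fin.val_castSucc, differ_self (vertexSide_mem hS _ _),
      sub_zero]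
  have hedge : ∀ j : Fin m, ∑ c : Fin 4,
      ((q' : ℤ) * differ (modelSide (p := p) (q := q) (p' := p') (q' := q') lo hi S
          (JoinIdx.toModel p q p' q' (.inr (j, c)))) (vertexSide S (hi j) j) +
        if c = 0 ∨ c = 1 then 0 else
          (p' : ℤ) * (1 - differ (modelSide (p := p) (q := q) (p' := p') (q' := q') lo hi S
          (JoinIdx.toModel p q p' q' (.inr (j, c)))) (vertexSide S (hi j) j))) =
      2 * p' + 2 * q' * differ (S (lo j)) (S (hi j)) := by
    intro j
    simp only [JoinIdx.toModel, modelSide, differ_vertexSide]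
    simp [Fin.sum_univ_four, connEnd, differ_self (hS _)]
    ring
  simp only [hlink, hconn, hedge, sum_covEdge, Finset.sum_const, Finset.card_univ,
    Fintype.card_fin, Fintype.card_prod, nsmul_eq_mul, Finset.sum_add_distrib, ← Finset.mul_sum]
  push_cast
  unfold baseValue
  linarith

end

/-! ### The parameters -/

theorem threshold_eq {n m : ℕ} (h : 2 * (m : ℤ) = 3 * n) (k : ℕ) :
    threshold n k = ((baseValue n m (paramP n) (paramQ n) (paramP' n) (paramQ' n) +
      (2 * paramQ' n + 4) * k : ℤ) : ℚ) := by
  have hm : (m : ℚ) = 3 * n / 2 := by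
    have : (2 * (m : ℤ) : ℚ) = 3 * n := by exact_mod_cast h
    push_cast at this
    linarith
  unfold threshold baseValue
  push_cast
  rw [hm]
  ring

theorem isSufficient_params {n : ℕ} (hn : 2 ≤ n) :
    IsSufficient n (paramP n) (paramQ n) (paramP' n) (paramQ' n) where
  two_le := hn
  le_q := by
    unfold paramQ paramQ'
    omega
  le_p := le_rfl
  le_p' := le_rfl
  sq_q := by
    unfold paramP
    -- From n³ ≥ 4n. It suffices because (p + q)·7n = 21nq + 49n².
    have h1 : 112 * n ≤ paramQ n := by
      unfold paramQ
      nlinarith [Nat.mul_le_mul hn hn, Nat.mul_le_mul_left n (Nat.mul_le_mul hn hn)]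
    nlinarith [Nat.mul_le_mul_left (paramQ n) h1, Nat.mul_le_mul_left n h1]
  sq_q' := by
    unfold paramP'
    have h1 : 72 * n ≤ paramQ' n := by
      unfold paramQ'
      nlinarith [Nat.mul_le_mul hn hn, Nat.mul_le_mul_left n (Nat.mul_le_mul hn hn)]
    nlinarith [Nat.mul_le_mul_left (paramQ' n) h1, Nat.mul_le_mul_left n h1]

/-- With 6m = 9n and n + 2 ≤ 2n the left side is at most 36n³, which is 2q' - 2. -/
theorem join_edges_lt {n m : ℕ} (hn : 2 ≤ n) (h : 2 * (m : ℤ) = 3 * n) :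
    6 * (m : ℤ) * (n + 2) ^ 2 < 2 * paramQ' n := by
  unfold paramQ'
  have h1 : (2 : ℤ) ≤ n := by exact_mod_cast hn
  have h2 : ((n : ℤ) + 2) ^ 2 ≤ 4 * n ^ 2 := by nlinarith
  have h3 : 6 * (m : ℤ) = 9 * n := by linarith
  rw [h3]
  push_cast
  nlinarith [mul_le_mul_of_nonneg_left h2 (by linarith : (0 : ℤ) ≤ 9 * n)]

end

end IntervalMaxCut

/-! ### The equivalence -/

theorem mainTheorem2 {V : Type*} [Fintype V] (G : SimpleGraph V) [DecidableRel G.Adj]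
    (hG : G.IsRegularOfDegree 3) {n m : ℕ} (πV : Fin n ≃ V) (πE : Fin m ≃ G.edgeSet)
    (M : ModelIdx n m (paramP n) (paramQ n) (paramP' n) (paramQ' n) → NonemptyInterval ℝ)
    (hM : IsReductionModel G πV πE M) (k : ℕ) (hk : 0 < k) :
    k ≤ maxCut G ↔ threshold n k ≤ (maxCut (intersectionGraph M) : ℚ) := by
  classical
  obtain ⟨lo, hi, hE⟩ := exists_areEnds πV πE
  have h2m := two_mul_card_edges hE hG
  rw [threshold_eq h2m]
  have hQ' : 0 < paramQ' n := Nat.succ_pos _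
  -- The empty graph is 3-regular. Both maximum cuts are then 0, and both inequalities fail because
  -- k > 0.
  rcases Nat.eq_zero_or_pos n with rfl | hn
  · obtain rfl : m = 0 := by omega
    have : IsEmpty V := πV.symm.isEmpty
    have : IsEmpty (ModelIdx 0 0 (paramP 0) (paramQ 0) (paramP' 0) (paramQ' 0)) :=
      ⟨by rintro ((⟨i, _, _⟩ | ⟨i, _, _⟩) | ⟨j, _⟩ | ⟨j, _⟩) <;> exact Fin.elim0 ‹Fin 0›⟩
    have hpos : 0 < (2 * paramQ' 0 + 4) * k := by positivity
    rw [maxCut_of_isEmpty, maxCut_of_isEmpty]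
    refine iff_of_false (by omega) (not_le.2 ?_)
    simp only [baseValue]
    push_cast
    have : (0 : ℚ) < (2 * paramQ' 0 + 4) * k := by exact_mod_cast hpos
    linarith
  have hn2 : 2 ≤ n := by
    have h := G.degree_lt_card_verts (πV ⟨0, hn⟩)
    rw [hG, ← Fintype.card_congr πV, Fintype.card_fin] at h
    omega
  have hl : IsLarge n m (paramP n) (paramQ n) (paramQ' n) :=
    ⟨hn2, by omega, by unfold paramP paramQ; omega, Nat.succ_pos _, hQ'⟩
  constructor
  · intro h
    obtain ⟨A, hA⟩ := (le_maxCut_iff G hk).1 h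
    set S : Fin n → ℤ := fun i => if πV i ∈ A then 1 else 0 with hSdef
    have hS : IsIndicator S := fun i => by
      by_cases h : πV i ∈ A <;> simp [hSdef, h]
    have hcut := ncard_cutSet_eq_sum_differ hE A hS fun i => by simp [hSdef]
    have hle := hM.le_cut hl hE hG hS
    have hM' := ncard_cutSet_of_isIndicator M (isIndicator_modelSide (lo := lo) (hi := hi) hS)
    have hmax := ncard_cutSet_le_maxCut (intersectionGraph M) {u | modelSide lo hi S u = 1}
    have hk' : (k : ℤ) ≤ ∑ j, differ (S (lo j)) (S (hi j)) := by
      rw [← hcut]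
      exact_mod_cast hA
    have hmul := mul_le_mul_of_nonneg_left hk' (by positivity : (0 : ℤ) ≤ 2 * paramQ' n + 4)
    have hmax' : ((cutSet (intersectionGraph M) {u | modelSide lo hi S u = 1}).ncard : ℤ) ≤
        maxCut (intersectionGraph M) := by exact_mod_cast hmax
    have : baseValue n m (paramP n) (paramQ n) (paramP' n) (paramQ' n) +
        (2 * paramQ' n + 4) * k ≤ (maxCut (intersectionGraph M) : ℤ) := by linarith
    exact_mod_cast this
  · intro h
    have h' : baseValue n m (paramP n) (paramQ n) (paramP' n) (paramQ' n) +
        (2 * paramQ' n + 4) * k ≤ (maxCut (intersectionGraph M) : ℤ) := by exact_mod_cast h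
    have hub : (maxCut (intersectionGraph M) : ℤ) ≤
        baseValue n m (paramP n) (paramQ n) (paramP' n) (paramQ' n) +
          2 * paramQ' n * maxCut G + 6 * m * (n + 2) ^ 2 := by
      obtain ⟨A, hA⟩ := exists_eq_ciSup_of_finite
        (f := fun A => (cutSet (intersectionGraph M) A).ncard)
      rw [maxCut, ← hA, ncard_cutSet_intersectionGraph]
      exact hM.cut_le hl (isSufficient_params hn2) hE hG fun u => by
        by_cases h : u ∈ A <;> simp [h]
    -- If mc(G) ≤ k - 1, the model has at most B + 2q'(k - 1) + 6m(n+2)² < B + 2q'k cut edges, below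
    -- the threshold.
    have hlt := join_edges_lt hn2 h2m
    by_contra hk'
    push Not at hk'
    have hk1 : (maxCut G : ℤ) + 1 ≤ k := by exact_mod_cast hk'
    have := mul_le_mul_of_nonneg_left hk1 (by positivity : (0 : ℤ) ≤ 2 * paramQ' n)
    have : (0 : ℤ) ≤ k := Int.natCast_nonneg k
    linarith
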